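/- **Theorem L5.** Let $(M,g)$ be a compact $d$-dimensional smooth Riemannian manifold without boundary, with Riemannian volume $\mathrm{vol}$, and let $U\in C^1(M)$ be such that $\pi(dx)=e^{-U(x)}\,\mathrm{vol}(dx)$ is a probability measure. Write $\langle\cdot,\cdot\rangle$ and $\|\cdot\|$ for the inner product and norm of the real space $L^2(M,\pi)$. Let $H^1\subset L^2(M,\pi)$ be the domain of the closure of the form $\langle f,h\rangle_{H^1}=\int_M\nabla f\cdot\nabla h\,d\pi$, $f,h\in C^\infty(M)$; we use the same notation $\langle\cdot,\cdot\rangle_{H^1}$ for the closed form, and convergence in $H^1$ means convergence in the norm $(\langle u,u\rangle_{H^1}+\|u\|^2)^{1/2}$. Let $A$ be the Friedrichs extension in $L^2(M,\pi)$ of $A_of=\Delta f-\nabla U\cdot\nabla f$, $f\in C^\infty(M)$. Let $b$ be a $C^1$ vector field on $M$ with $\mathrm{div}(e^{-U}b)=0$, and let $B$, with domain $H^1$, be the continuous extension of $f\mapsto b\cdot\nabla f$ from $C^\infty(M)$ to $H^1$, with values in $L^2(M,\pi)$. For $c\in\mathbb R$ put $A_c=A+cB$ on $\mathrm{Dom}(A)$.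 Let $\lambda>0$. Then $A-\lambda$ and all $A_c-\lambda$, $c\in\mathbb R$, have bounded everywhere defined inverses on $L^2(M,\pi)$. Put $R^{(c)}_\lambda=-(A_c-\lambda)^{-1}$. Every $u\in H^1$ has a unique orthogonal projection $P_{1,\lambda}u$ onto $$K=\mathrm{Ker}(B)\cap H^1=\{\varphi\in H^1: B\varphi=0\}$$ with respect to the inner product $\langle\psi,\varphi\rangle_{1,\lambda}=\langle\psi,\varphi\rangle_{H^1}+\lambda\langle\psi,\varphi\rangle$ on $H^1$. For every $g\in L^2(M,\pi)$ the functions $(A-\lambda)^{-1}g$ and $R^{(c)}_\lambda g$ lie in $H^1$, and $$R^{(c)}_\lambda g\longrightarrow R^*_\lambda g:=-P_{1,\lambda}(A-\lambda)^{-1}g\in K\qquad\text{in } H^1\text{ as }|c|\to\infty .$$ Moreover, if $\int_M g\,d\pi=0$, then all $R^{(c)}_\lambda g$ and $R^*_\lambda g$ have mean zero. -/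

import Mathlib

open scoped Manifold ContDiff Topology ENNReal
open MeasureTheory Filter Bundle

noncomputable section

namespace DriftLimit

/-! ### Linear algebra of unbounded operators -/

section Operators

variable {H : Type*} [NormedAddCommGroup H] [InnerProductSpace ℝ H]

/-- `S` is the bounded inverse `(T - lam)⁻¹` of the unbounded operator `T - lam`, where
`T - lam` has the domain of `T`. -/
def IsShiftInverse (T : H →ₗ.[ℝ] H) (lam : ℝ) (S : H →L[ℝ] H) : Prop :=
  (∀ g : H, ∃ h : S g ∈ T.domain, T ⟨S g, h⟩ - lam • S g = g) ∧
    ∀ ψ : T.domain, S (T ψ - lam • (ψ : H)) = ψ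

open Classical in
/-- The operator `(T - lam)⁻¹` (and `0` when `T - lam` has no bounded inverse). -/
def shiftInverse (T : H →ₗ.[ℝ] H) (lam : ℝ) : H →L[ℝ] H :=
  if h : ∃ S : H →L[ℝ] H, IsShiftInverse T lam S then h.choose else 0

/-- The resolvent `R_lam = -(T - lam)⁻¹`. -/
def resolventOp (T : H →ₗ.[ℝ] H) (lam : ℝ) : H →L[ℝ] H :=
  -shiftInverse T lam

end Operators

/-! ### Riemannian geometry: volume, gradient, divergence, Laplacian -/

section Geometry

variable (d : ℕ) {M : Type*} [TopologicalSpace M] [ChartedSpace (EuclideanSpace ℝ (Fin d)) M]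

/-- The `j`-th coordinate vector field `∂_j` of the chart `e`, at the point with coordinates `y`. -/
def coordVec (e : OpenPartialHomeomorph M (EuclideanSpace ℝ (Fin d)))
    (y : EuclideanSpace ℝ (Fin d)) (j : Fin d) : TangentSpace (𝓡 d) (e.symm y) :=
  mfderiv (𝓡 d) (𝓡 d) e.symm y (EuclideanSpace.single j (1 : ℝ) : EuclideanSpace ℝ (Fin d))

/-- The components, in the chart `e`, of the vector field `X` at the point with coordinates `y`. -/
def coordComp (e : OpenPartialHomeomorph M (EuclideanSpace ℝ (Fin d)))
    (X : (x : M) → TangentSpace (𝓡 d) x) (y : EuclideanSpace ℝ (Fin d)) :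
    EuclideanSpace ℝ (Fin d) :=
  mfderiv (𝓡 d) (𝓡 d) e (e.symm y) (X (e.symm y))

variable [RiemannianBundle (fun x : M => TangentSpace (𝓡 d) x)]

/-- The function `√g`, the square root of the determinant of the matrix `g(∂_j, ∂_k)`,
in the chart `e`. -/
def sqrtDet (e : OpenPartialHomeomorph M (EuclideanSpace ℝ (Fin d)))
    (y : EuclideanSpace ℝ (Fin d)) : ℝ :=
  √(Matrix.of fun j k : Fin d => inner ℝ (coordVec d e y j) (coordVec d e y k)).det

/-- The Riemannian volume measure. In a chart `e` it is `√g dy`; the measure on `M` is the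
smallest one that dominates all these measures on the chart domains (they agree on overlaps). -/
def riemVol [MeasurableSpace M] : Measure M :=
  ⨆ e ∈ atlas (EuclideanSpace ℝ (Fin d)) M,
    ((volume.restrict e.target).withDensity
      (fun y => ENNReal.ofReal (sqrtDet d e y))).map e.symm

/-- The measure `π(dx) = exp(-U(x)) vol(dx)`. -/
def gibbs [MeasurableSpace M] (U : M → ℝ) : Measure M :=
  (riemVol d).withDensity fun x => ENNReal.ofReal (Real.exp (-U x))

/-- The divergence `(1/√g) ∑_j ∂_j (√g X^j)`, computed at `x` in the preferred chart at `x`. -/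
def divergence (X : (x : M) → TangentSpace (𝓡 d) x) (x : M) : ℝ :=
  let e := chartAt (EuclideanSpace ℝ (Fin d)) x
  (sqrtDet d e (e x))⁻¹ * ∑ j : Fin d,
    fderiv ℝ (fun y => sqrtDet d e y * coordComp d e X y j) (e x) (EuclideanSpace.single j 1)

variable [IsManifold (𝓡 d) ∞ M]

instance (x : M) : FiniteDimensional ℝ (TangentSpace (𝓡 d) x) :=
  inferInstanceAs (FiniteDimensional ℝ (EuclideanSpace ℝ (Fin d)))

instance (x : M) : CompleteSpace (TangentSpace (𝓡 d) x) :=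
  FiniteDimensional.complete ℝ (TangentSpace (𝓡 d) x)

/-- The Riemannian gradient: `g(∇f(x), v) = df_x(v)` for all tangent vectors `v`. -/
def grad (f : M → ℝ) (x : M) : TangentSpace (𝓡 d) x :=
  (InnerProductSpace.toDual ℝ (TangentSpace (𝓡 d) x)).symm (mfderiv (𝓡 d) 𝓘(ℝ, ℝ) f x)

/-- The Laplace operator `Δ f = div ∇f`. -/
def laplacian (f : M → ℝ) (x : M) : ℝ :=
  divergence d (grad d f) x

end Geometry

set_option linter.unusedSectionVars false

/-! ### The spaces `L²(M,π)` and `H¹`, the operators `A` and `B` -/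

section Analysis

variable (d : ℕ) {M : Type*} [TopologicalSpace M] [ChartedSpace (EuclideanSpace ℝ (Fin d)) M]
  [IsManifold (𝓡 d) ∞ M] [RiemannianBundle (fun x : M => TangentSpace (𝓡 d) x)]


/-- The norm of the gradient of a smooth function is continuous. -/
theorem continuous_norm_grad
    [IsContMDiffRiemannianBundle (𝓡 d) ∞ (EuclideanSpace ℝ (Fin d))
      (fun x : M => TangentSpace (𝓡 d) x)]
    (f : C^∞⟮𝓡 d, M; 𝓘(ℝ, ℝ), ℝ⟯) : Continuous fun x => ‖grad d f x‖ := by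
  have hcont : IsContinuousRiemannianBundle (EuclideanSpace ℝ (Fin d))
      (fun x : M => TangentSpace (𝓡 d) x) := by
    obtain ⟨g, hg, hg'⟩ := IsContMDiffRiemannianBundle.exists_contMDiff (IB := 𝓡 d) (n := ∞)
      (F := EuclideanSpace ℝ (Fin d)) (E := fun x : M => TangentSpace (𝓡 d) x)
    exact ⟨g, hg.continuous, hg'⟩
  let D : (x : M) → TangentSpace (𝓡 d) x →L[ℝ] ℝ := fun x => mfderiv (𝓡 d) 𝓘(ℝ, ℝ) f x
  have hn : ∀ x, ‖grad d f x‖ = ‖D x‖ := fun x =>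
    (InnerProductSpace.toDual ℝ (TangentSpace (𝓡 d) x)).symm.norm_map _
  simp only [hn]
  rw [continuous_iff_continuousAt]
  intro x
  let e := trivializationAt (EuclideanSpace ℝ (Fin d)) (fun x : M => TangentSpace (𝓡 d) x) x
  let c : M → (EuclideanSpace ℝ (Fin d) →L[ℝ] ℝ) := fun y => (D y) ∘L (e.symmL ℝ y)
  have hc : ContinuousAt c x := by
    have h := (ContMDiffAt.mfderiv_const (m := 0) (n := ∞) (f.contMDiff x)
      (by simp)).continuousAt
    refine h.congr (Filter.Eventually.of_forall fun y => ?_)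
    simp only [inTangentCoordinates, ContinuousLinearMap.inCoordinates, 
      TangentBundle.continuousLinearMapAt_model_space]
    rfl
  let P := e.continuousLinearMapAt ℝ x
  have ha : ContinuousAt (fun y => ‖(c y) ∘L P‖) x :=
    (((ContinuousLinearMap.compL ℝ (TangentSpace (𝓡 d) x) (EuclideanSpace ℝ (Fin d)) ℝ).flip P).continuous.continuousAt.comp hc).norm
  have hmem : ∀ᶠ y in 𝓝 x, y ∈ e.baseSet :=
    e.open_baseSet.mem_nhds (FiberBundle.mem_baseSet_trivializationAt' x)
  have hx : x ∈ e.baseSet := hmem.self_of_nhds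
  have h0 : ‖(c x) ∘L P‖ = ‖D x‖ := by
    congr 1
    ext v
    simp only [ContinuousLinearMap.comp_apply, c, P]
    rw [e.symmL_continuousLinearMapAt hx]
  have h1 : ∀ r : ℝ, 1 < r → ∀ᶠ y in 𝓝 x, ‖D y‖ ≤ ‖(c y) ∘L P‖ * r := by
    intro r hr
    filter_upwards [eventually_norm_symmL_trivializationAt_self_comp_lt
      (EuclideanSpace ℝ (Fin d)) (fun x : M => TangentSpace (𝓡 d) x) x hr, hmem] with y hy hm
    have : D y = ((c y) ∘L P) ∘L ((e.symmL ℝ x) ∘L (e.continuousLinearMapAt ℝ y)) := by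
      ext v
      simp only [ContinuousLinearMap.comp_apply, c, P]
      rw [e.continuousLinearMapAt_symmL hx, e.symmL_continuousLinearMapAt hm]
    calc ‖D y‖ = _ := congrArg norm this
      _ ≤ _ := ContinuousLinearMap.opNorm_comp_le _ _
      _ ≤ _ := by gcongr
  have h2 : ∀ r : ℝ, 1 < r → ∀ᶠ y in 𝓝 x, ‖(c y) ∘L P‖ ≤ ‖D y‖ * r := by
    intro r hr
    filter_upwards [eventually_norm_symmL_trivializationAt_comp_self_lt
      (EuclideanSpace ℝ (Fin d)) (fun x : M => TangentSpace (𝓡 d) x) x hr] with y hy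
    calc ‖(c y) ∘L P‖ = ‖(D y) ∘L ((e.symmL ℝ y) ∘L P)‖ := rfl
      _ ≤ _ := ContinuousLinearMap.opNorm_comp_le _ _
      _ ≤ _ := by gcongr
  have hm : Tendsto (fun y => ‖(c y) ∘L P‖) (𝓝 x) (𝓝 ‖D x‖) := h0 ▸ ha.tendsto
  refine tendsto_order.2 ⟨fun a haD => ?_, fun a haD => ?_⟩
  · rcases lt_or_ge a 0 with hneg | hpos
    · exact Filter.Eventually.of_forall fun y => hneg.trans_le (D y).opNorm_nonneg
    · have hD : 0 < ‖D x‖ := hpos.trans_lt haD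
      obtain ⟨r, hr1, hr2⟩ : ∃ r : ℝ, 1 < r ∧ a * r < ‖D x‖ := by
        have hev : ∀ᶠ r in 𝓝[>] (1 : ℝ), a * r < ‖D x‖ := by
          have : Tendsto (fun r : ℝ => a * r) (𝓝 1) (𝓝 (a * 1)) :=
            tendsto_const_nhds.mul tendsto_id
          exact nhdsWithin_le_nhds ((tendsto_order.1 this).2 _ (by simpa using haD))
        have hev2 : ∀ᶠ r in 𝓝[>] (1 : ℝ), 1 < r := self_mem_nhdsWithin
        exact (hev2.and hev).exists
      filter_upwards [h2 r hr1, (tendsto_order.1 hm).1 _ hr2] with y hy1 hy2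
      exact lt_of_mul_lt_mul_right (hy2.trans_le hy1) (by linarith)
  · obtain ⟨r, hr1, hr2⟩ : ∃ r : ℝ, 1 < r ∧ ‖D x‖ * r < a := by
      have hev : ∀ᶠ r in 𝓝[>] (1 : ℝ), ‖D x‖ * r < a := by
        have : Tendsto (fun r : ℝ => ‖D x‖ * r) (𝓝 1) (𝓝 (‖D x‖ * 1)) :=
          tendsto_const_nhds.mul tendsto_id
        exact nhdsWithin_le_nhds ((tendsto_order.1 this).2 _ (by simpa using haD))
      have hev2 : ∀ᶠ r in 𝓝[>] (1 : ℝ), 1 < r := self_mem_nhdsWithin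
      exact (hev2.and hev).exists
    have hmr : Tendsto (fun y => ‖(c y) ∘L P‖ * r) (𝓝 x) (𝓝 (‖D x‖ * r)) :=
      hm.mul tendsto_const_nhds
    filter_upwards [h1 r hr1, (tendsto_order.1 hmr).2 _ hr2] with y hy1 hy2
    exact hy1.trans_lt hy2

/-- The gradient is linear on smooth functions. -/
theorem grad_add (f h : C^∞⟮𝓡 d, M; 𝓘(ℝ, ℝ), ℝ⟯) (x : M) :
    grad d (⇑(f + h)) x = grad d f x + grad d h x := by
  have hf := f.mdifferentiableAt (x := x)
  have hh := h.mdifferentiableAt (x := x)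
  have key : mfderiv (𝓡 d) 𝓘(ℝ, ℝ) (⇑(f + h)) x =
      @HAdd.hAdd (TangentSpace (𝓡 d) x →L[ℝ] ℝ) (TangentSpace (𝓡 d) x →L[ℝ] ℝ)
        (TangentSpace (𝓡 d) x →L[ℝ] ℝ) _ (mfderiv (𝓡 d) 𝓘(ℝ, ℝ) f x)
        (mfderiv (𝓡 d) 𝓘(ℝ, ℝ) h x) :=
    mfderiv_add hf hh
  unfold grad
  exact (congrArg (InnerProductSpace.toDual ℝ (TangentSpace (𝓡 d) x)).symm key).trans
    (map_add (InnerProductSpace.toDual ℝ (TangentSpace (𝓡 d) x)).symm _ _)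

theorem grad_smul (a : ℝ) (f : C^∞⟮𝓡 d, M; 𝓘(ℝ, ℝ), ℝ⟯) (x : M) :
    grad d (⇑(a • f)) x = a • grad d f x := by
  have hf := f.mdifferentiableAt (x := x)
  have key : mfderiv (𝓡 d) 𝓘(ℝ, ℝ) (⇑(a • f)) x =
      (a • (mfderiv (𝓡 d) 𝓘(ℝ, ℝ) f x : TangentSpace (𝓡 d) x →L[ℝ] ℝ) :
          TangentSpace (𝓡 d) x →L[ℝ] ℝ) :=
    const_smul_mfderiv hf a
  unfold grad
  refine (congrArg (InnerProductSpace.toDual ℝ (TangentSpace (𝓡 d) x)).symm key).trans ?_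
  exact (InnerProductSpace.toDual ℝ (TangentSpace (𝓡 d) x)).symm.map_smulₛₗ a _

variable [MeasurableSpace M]

/-- The Dirichlet form `∫ ∇f · ∇h dμ` on smooth functions. -/
def energy (μ : Measure M) (f h : C^∞⟮𝓡 d, M; 𝓘(ℝ, ℝ), ℝ⟯) : ℝ :=
  ∫ x, inner ℝ (grad d f x) (grad d h x) ∂μ

theorem energy_smul_self (μ : Measure M) (a : ℝ) (f : C^∞⟮𝓡 d, M; 𝓘(ℝ, ℝ), ℝ⟯) :
    energy d μ (a • f) (a • f) = a ^ 2 * energy d μ f f := by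
  unfold energy
  rw [← integral_const_mul]
  refine integral_congr_ae (Filter.Eventually.of_forall fun x => ?_)
  simp only [grad_smul, inner_smul_left, inner_smul_right]
  simp
  ring

theorem energy_self_nonneg (μ : Measure M) (f : C^∞⟮𝓡 d, M; 𝓘(ℝ, ℝ), ℝ⟯) :
    0 ≤ energy d μ f f :=
  integral_nonneg fun _ => real_inner_self_nonneg

theorem energy_add_self_le [BorelSpace M] [CompactSpace M]
    [IsContMDiffRiemannianBundle (𝓡 d) ∞ (EuclideanSpace ℝ (Fin d))
      (fun x : M => TangentSpace (𝓡 d) x)]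
    (μ : Measure M) [IsFiniteMeasure μ] (f h : C^∞⟮𝓡 d, M; 𝓘(ℝ, ℝ), ℝ⟯) :
    energy d μ (f + h) (f + h) ≤ 2 * energy d μ f f + 2 * energy d μ h h := by
  have hint : ∀ k : C^∞⟮𝓡 d, M; 𝓘(ℝ, ℝ), ℝ⟯,
      Integrable (fun x => inner ℝ (grad d k x) (grad d k x)) μ := by
    intro k
    simp only [real_inner_self_eq_norm_sq]
    exact ((continuous_norm_grad d k).pow 2).integrable_of_hasCompactSupport
      (HasCompactSupport.of_compactSpace _)
  unfold energy
  rw [← integral_const_mul, ← integral_const_mul, ← integral_add ((hint f).const_mul 2)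
    ((hint h).const_mul 2)]
  refine integral_mono (hint _) (((hint f).const_mul 2).add ((hint h).const_mul 2)) fun x => ?_
  simp only [grad_add, real_inner_self_eq_norm_sq]
  nlinarith [parallelogram_law_with_norm ℝ (grad d f x) (grad d h x),
    norm_nonneg (grad d f x - grad d h x)]

section Spaces

variable [BorelSpace M] [CompactSpace M] (μ : Measure M) [IsFiniteMeasure μ]

/-- The class in `L²(M,μ)` of a smooth function. -/
def toL2 (f : C^∞⟮𝓡 d, M; 𝓘(ℝ, ℝ), ℝ⟯) : Lp ℝ 2 μ :=
  ContinuousMap.toLp (E := ℝ) 2 μ ℝ ⟨f, f.contMDiff.continuous⟩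

theorem toL2_add (f h : C^∞⟮𝓡 d, M; 𝓘(ℝ, ℝ), ℝ⟯) :
    toL2 d μ (f + h) = toL2 d μ f + toL2 d μ h :=
  map_add (ContinuousMap.toLp (E := ℝ) 2 μ ℝ) ⟨f, f.contMDiff.continuous⟩
    ⟨h, h.contMDiff.continuous⟩

theorem toL2_smul (a : ℝ) (f : C^∞⟮𝓡 d, M; 𝓘(ℝ, ℝ), ℝ⟯) :
    toL2 d μ (a • f) = a • toL2 d μ f :=
  map_smul (ContinuousMap.toLp (E := ℝ) 2 μ ℝ) a ⟨f, f.contMDiff.continuous⟩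

/-- The smooth functions `f n` converge to `u` in the sense of `H¹`: they converge to `u` in `L²`
and are a Cauchy sequence for the Dirichlet form. -/
def IsH1Limit (f : ℕ → C^∞⟮𝓡 d, M; 𝓘(ℝ, ℝ), ℝ⟯) (u : Lp ℝ 2 μ) : Prop :=
  Tendsto (fun n => toL2 d μ (f n)) atTop (𝓝 u) ∧
    Tendsto (fun p : ℕ × ℕ => energy d μ (f p.1 - f p.2) (f p.1 - f p.2)) atTop (𝓝 0)

variable {d μ}

theorem IsH1Limit.add [IsContMDiffRiemannianBundle (𝓡 d) ∞ (EuclideanSpace ℝ (Fin d))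
      (fun x : M => TangentSpace (𝓡 d) x)]
    {f h : ℕ → C^∞⟮𝓡 d, M; 𝓘(ℝ, ℝ), ℝ⟯} {u v : Lp ℝ 2 μ}
    (hf : IsH1Limit d μ f u) (hh : IsH1Limit d μ h v) :
    IsH1Limit d μ (fun n => f n + h n) (u + v) := by
  refine ⟨by simpa only [toL2_add] using hf.1.add hh.1, ?_⟩
  have hlim := (hf.2.const_mul 2).add (hh.2.const_mul 2)
  simp only [mul_zero, add_zero] at hlim
  refine squeeze_zero (fun _ => energy_self_nonneg d μ _) (fun p => ?_) hlim
  rw [add_sub_add_comm]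
  exact energy_add_self_le d μ _ _

theorem IsH1Limit.smul {f : ℕ → C^∞⟮𝓡 d, M; 𝓘(ℝ, ℝ), ℝ⟯} {u : Lp ℝ 2 μ}
    (hf : IsH1Limit d μ f u) (a : ℝ) : IsH1Limit d μ (fun n => a • f n) (a • u) := by
  refine ⟨by simpa only [toL2_smul] using hf.1.const_smul a, ?_⟩
  have hlim := hf.2.const_mul (a ^ 2)
  simp only [mul_zero] at hlim
  refine hlim.congr fun p => ?_
  rw [← smul_sub, energy_smul_self]

theorem isH1Limit_zero : IsH1Limit d μ (fun _ => 0) 0 := by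
  have h0 : toL2 d μ 0 = 0 := by
    have := toL2_smul d μ 0 0
    simpa using this
  have h1 : energy d μ 0 0 = 0 := by
    have := energy_smul_self d μ 0 0
    simpa using this
  exact ⟨by simp [h0], by simp [h1]⟩

variable (d μ)

open Classical in
/-- A sequence of smooth functions that converges to `u` in the sense of `H¹`, for `u ∈ H¹`. -/
def h1Seq (u : Lp ℝ 2 μ) : ℕ → C^∞⟮𝓡 d, M; 𝓘(ℝ, ℝ), ℝ⟯ :=
  if h : ∃ f, IsH1Limit d μ f u then h.choose else 0

/-- The inner product `⟨u, v⟩_{H¹}`: the extension of `∫ ∇u · ∇v dμ` from smooth functions to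
`H¹` by continuity. -/
def innerH1 (u v : Lp ℝ 2 μ) : ℝ :=
  limUnder atTop fun n => energy d μ (h1Seq d μ u n) (h1Seq d μ v n)

/-- The inner product `⟨u, v⟩_{1,lam} = ⟨u, v⟩_{H¹} + lam ⟨u, v⟩` on `H¹`. -/
def innerH1Shift (lam : ℝ) (u v : Lp ℝ 2 μ) : ℝ :=
  innerH1 d μ u v + lam * inner ℝ u v

/-- The Sobolev norm of an element of `H¹`. -/
def normH1 (u : Lp ℝ 2 μ) : ℝ :=
  √(innerH1 d μ u u + ‖u‖ ^ 2)

variable [IsContMDiffRiemannianBundle (𝓡 d) ∞ (EuclideanSpace ℝ (Fin d))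
      (fun x : M => TangentSpace (𝓡 d) x)]

/-- The Sobolev space `H¹`, the domain of the closure of the Dirichlet form on smooth
functions. -/
def sobolevH1 : Submodule ℝ (Lp ℝ 2 μ) where
  carrier := {u | ∃ f, IsH1Limit d μ f u}
  add_mem' := fun ⟨_, hf⟩ ⟨_, hh⟩ => ⟨_, hf.add hh⟩
  zero_mem' := ⟨_, isH1Limit_zero⟩
  smul_mem' := fun a _ ⟨_, hf⟩ => ⟨_, hf.smul a⟩

/-- The graph of `B`: the pairs `(u, lim b·∇(f n))` where the smooth functions `f n` converge to
`u` in the sense of `H¹` and the limit is taken in `L²`. -/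
def driftGraph (b : (x : M) → TangentSpace (𝓡 d) x) :
    Submodule ℝ (Lp ℝ 2 μ × Lp ℝ 2 μ) where
  carrier := {p | ∃ f, IsH1Limit d μ f p.1 ∧ ∃ w : ℕ → Lp ℝ 2 μ,
    (∀ n, w n =ᵐ[μ] fun x => inner ℝ (b x) (grad d (f n) x)) ∧ Tendsto w atTop (𝓝 p.2)}
  add_mem' := by
    rintro p q ⟨f, hf, w, hw, hwl⟩ ⟨h, hh, z, hz, hzl⟩
    refine ⟨_, hf.add hh, fun n => w n + z n, fun n => ?_, hwl.add hzl⟩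
    filter_upwards [Lp.coeFn_add (w n) (z n), hw n, hz n] with x h1 h2 h3
    rw [h1, Pi.add_apply, h2, h3, grad_add, inner_add_right]
  zero_mem' := by
    refine ⟨_, isH1Limit_zero, fun _ => 0, fun n => ?_, tendsto_const_nhds⟩
    filter_upwards [Lp.coeFn_zero ℝ 2 μ] with x h1
    have h2 := grad_smul d (0 : ℝ) (0 : C^∞⟮𝓡 d, M; 𝓘(ℝ, ℝ), ℝ⟯) x
    simp only [zero_smul] at h2
    rw [h1, h2, inner_zero_right]
    rfl
  smul_mem' := by
    rintro a p ⟨f, hf, w, hw, hwl⟩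
    refine ⟨_, hf.smul a, fun n => a • w n, fun n => ?_, hwl.const_smul a⟩
    filter_upwards [Lp.coeFn_smul a (w n), hw n] with x h1 h2
    rw [h1, Pi.smul_apply, h2, grad_smul, inner_smul_right, smul_eq_mul]

/-- The operator `B` with domain `H¹`: the extension of `f ↦ b·∇f` from smooth functions to `H¹`
by continuity. -/
def driftOp (b : (x : M) → TangentSpace (𝓡 d) x) : Lp ℝ 2 μ →ₗ.[ℝ] Lp ℝ 2 μ :=
  (driftGraph d μ b).toLinearPMap

/-- The space `K = Ker(B) ∩ H¹`. -/
def driftKer (b : (x : M) → TangentSpace (𝓡 d) x) : Submodule ℝ (Lp ℝ 2 μ) :=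
  sobolevH1 d μ ⊓ (LinearMap.ker (driftOp d μ b).toFun).map (driftOp d μ b).domain.subtype

/-- `p` is the orthogonal projection of `u` onto `K = Ker(B) ∩ H¹` with respect to the inner
product `⟨·,·⟩_{1,lam}`. -/
def IsKerProj (b : (x : M) → TangentSpace (𝓡 d) x) (lam : ℝ) (u p : Lp ℝ 2 μ) : Prop :=
  p ∈ driftKer d μ b ∧ ∀ k ∈ driftKer d μ b, innerH1Shift d μ lam (u - p) k = 0

open Classical in
/-- The orthogonal projection `P_{1,lam}` onto `K` with respect to `⟨·,·⟩_{1,lam}`, as a map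
on `H¹`. -/
def kerProj (b : (x : M) → TangentSpace (𝓡 d) x) (lam : ℝ) (u : Lp ℝ 2 μ) : Lp ℝ 2 μ :=
  if h : ∃ p, IsKerProj d μ b lam u p then h.choose else 0

end Spaces

section Generator

variable [BorelSpace M] [CompactSpace M] (U : M → ℝ) [IsFiniteMeasure (gibbs d U)]

/-- The differential operator `A_o f = Δ f - ∇U · ∇f` on smooth functions. -/
def coreOp (f : C^∞⟮𝓡 d, M; 𝓘(ℝ, ℝ), ℝ⟯) (x : M) : ℝ :=
  laplacian d f x - inner ℝ (grad d U x) (grad d f x)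

variable [IsContMDiffRiemannianBundle (𝓡 d) ∞ (EuclideanSpace ℝ (Fin d))
      (fun x : M => TangentSpace (𝓡 d) x)]

/-- The graph of the Friedrichs extension of `A_o` in `L²(M,π)`: the graph of the adjoint of `A_o`,
restricted to the form domain `H¹`. -/
def generatorGraph : Submodule ℝ (Lp ℝ 2 (gibbs d U) × Lp ℝ 2 (gibbs d U)) where
  carrier := {p | p.1 ∈ sobolevH1 d (gibbs d U) ∧
    ∀ (f : C^∞⟮𝓡 d, M; 𝓘(ℝ, ℝ), ℝ⟯) (w : Lp ℝ 2 (gibbs d U)),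
      w =ᵐ[gibbs d U] coreOp d U f → inner ℝ p.1 w = inner ℝ p.2 (toL2 d (gibbs d U) f)}
  add_mem' := by
    rintro p q ⟨hp, hp'⟩ ⟨hq, hq'⟩
    refine ⟨add_mem hp hq, fun f w hw => ?_⟩
    simp only [Prod.fst_add, Prod.snd_add, inner_add_left, hp' f w hw, hq' f w hw]
  zero_mem' := ⟨zero_mem _, fun f w _ => by simp⟩
  smul_mem' := by
    rintro a p ⟨hp, hp'⟩
    refine ⟨Submodule.smul_mem _ a hp, fun f w hw => ?_⟩
    simp only [Prod.smul_fst, Prod.smul_snd, inner_smul_left, hp' f w hw]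

/-- The generator `A`, the Friedrichs extension of `A_o`. -/
def generator : Lp ℝ 2 (gibbs d U) →ₗ.[ℝ] Lp ℝ 2 (gibbs d U) :=
  (generatorGraph d U).toLinearPMap

/-- The operator `A_c = A + c B`. -/
def driftGenerator (b : (x : M) → TangentSpace (𝓡 d) x) (c : ℝ) :
    Lp ℝ 2 (gibbs d U) →ₗ.[ℝ] Lp ℝ 2 (gibbs d U) :=
  generator d U + c • driftOp d (gibbs d U) b

/-- The limit `R*_lam g = -P_{1,lam} (A - lam)⁻¹ g`. -/
def limitResolvent (b : (x : M) → TangentSpace (𝓡 d) x) (lam : ℝ) (g : Lp ℝ 2 (gibbs d U)) :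
    Lp ℝ 2 (gibbs d U) :=
  -kerProj d (gibbs d U) b lam (shiftInverse (generator d U) lam g)

end Generator

end Analysis

end DriftLimit

end

set_option linter.unusedSectionVars false

/-! Let V be H¹ with the inner product ⟨·,·⟩_{1,lam}, ι : V → L² the inclusion and J = ι* its
adjoint. Since ⟨Jg, φ⟩_{1,lam} = ⟨g, φ⟩ for φ in H¹, Jg is the weak solution of (lam - A)u = g, that
is, Jg = -(A - lam)⁻¹g. Put T = J B, a bounded operator on V. Applying J turns (lam - A - cB)u = g
into the bounded equation (1 - cT)u = Jg on V, so that R_c g = (1 - cT)⁻¹Jg. As div(e^{-U}b) = 0, B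
is antisymmetric in L², hence T is skew-adjoint on V. Therefore 1 - cT is invertible, and its
inverse is a contraction for every real c.

The limit is the mean ergodic argument. On Ker T the inverse (1 - cT)⁻¹ is the identity. On a vector
Ty it gives c⁻¹((1 - cT)⁻¹y - y), which tends to 0. The contraction bound extends this to the
closure of the range, which contains (Ker T)^⊥ because T* = -T. So (1 - cT)⁻¹Jg tends to the
orthogonal projection of Jg on Ker T (`tendsto_resolvent_skew`), and Ker T = Ker B because J is
injective, ι having dense range. Convergence in V is convergence in H¹. Means are preserved since 1
lies in Ker T and ⟨v, 1⟩_{1,lam} = lam ∫ v dπ.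

Three facts connect this with the manifold: Green's formula for A_o (`energy_gibbs_eq`), the
antisymmetry of b·∇ (`integral_drift_mul`) and the density of smooth functions (`denseRange_toL2`).
Green's formula also gives the closability of the Dirichlet form, that is, the injectivity of ι. The
first two facts follow from the divergence theorem (`IsC1Field.integral_mul_divergence`), proved in
charts with a partition of unity. For this the Riemannian volume, defined as a supremum, must be √g
dy in each chart (`riemVol_apply`), and the divergence must not depend on the chart
(`IsC1Field.chartDiv_eq`). -/

namespace DriftLimit

/-! ### Resolvents of skew-adjoint operators -/

section SkewAdjoint

variable {V : Type*} [NormedAddCommGroup V] [InnerProductSpace ℝ V]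

/-- Pairing the equation with `x` kills the skew term and leaves ‖x‖² = ⟨y, x⟩. The bound is uniform
in `c`, which is what the limit needs. -/
theorem norm_le_of_sub_smul_skew {T : V →L[ℝ] V} (hT : ∀ v w, inner ℝ (T v) w = -inner ℝ v (T w))
    {c : ℝ} {x y : V} (h : x - c • T x = y) : ‖x‖ ≤ ‖y‖ := by
  have h0 : inner ℝ (T x) x = 0 := by
    have h := hT x x
    rw [real_inner_comm (T x) x] at h
    linarith
  have h1 : ‖x‖ * ‖x‖ = inner ℝ y x := by
    rw [← h, inner_sub_left, inner_smul_left, h0, real_inner_self_eq_norm_mul_norm]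
    simp
  have h2 := real_inner_le_norm y x
  rcases (norm_nonneg x).eq_or_lt with h3 | h3
  · rw [← h3]; positivity
  · exact le_of_mul_le_mul_right (h1.trans_le h2) h3

/-- The quadratic form of 1 - cT is exactly ‖x‖², so the operator is coercive. -/
theorem isUnit_one_sub_smul_skew [CompleteSpace V] {T : V →L[ℝ] V}
    (hT : ∀ v w, inner ℝ (T v) w = -inner ℝ v (T w)) (c : ℝ) : IsUnit (1 - c • T) := by
  refine ContinuousLinearMap.isUnit_of_forall_le_norm_inner_map _ one_pos fun x => ?_
  have h0 : inner ℝ (T x) x = 0 := by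
    have h := hT x x
    rw [real_inner_comm (T x) x] at h
    linarith
  have h1 : inner ℝ ((1 - c • T) x) x = ‖x‖ ^ 2 := by
    simp [inner_sub_left, inner_smul_left, h0]
  rw [h1]
  simp

theorem mem_closure_range_of_mem_ker_orthogonal [CompleteSpace V] {T : V →L[ℝ] V}
    (hT : ∀ v w, inner ℝ (T v) w = -inner ℝ v (T w)) {w : V}
    (hw : ∀ k, T k = 0 → inner ℝ w k = 0) : w ∈ closure (Set.range T) := by
  have h1 : w ∈ ((LinearMap.range T.toLinearMap)ᗮ)ᗮ := by
    rw [Submodule.mem_orthogonal']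
    intro k hk
    refine hw k ?_
    rw [Submodule.mem_orthogonal] at hk
    -- Testing against T(Tk) gives ‖Tk‖² = 0: the complement of the range lies in the kernel.
    have h2 := hk (T (T k)) ⟨T k, rfl⟩
    rw [hT] at h2
    simpa using h2
  rw [Submodule.orthogonal_orthogonal_eq_closure] at h1
  have h2 : w ∈ closure ((LinearMap.range T.toLinearMap : Submodule ℝ V) : Set V) := h1
  rwa [LinearMap.coe_range] at h2

/-- With Ty close to v - p, the vector x c - p + c⁻¹y solves the same equation with the right-hand
side (v - p - Ty) + c⁻¹y. The contraction bound then gives ‖x c - p‖ ≤ ‖v - p - Ty‖ + 2‖y‖/|c|. -/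
theorem tendsto_resolvent_skew {T : V →L[ℝ] V}
    (hT : ∀ v w, inner ℝ (T v) w = -inner ℝ v (T w)) {x : ℝ → V} {v p : V}
    (hx : ∀ c, x c - c • T (x c) = v) (hp : T p = 0) (hvp : v - p ∈ closure (Set.range T)) :
    Tendsto x (Bornology.cobounded ℝ) (𝓝 p) := by
  rw [Metric.tendsto_nhds]
  intro ε hε
  obtain ⟨_, ⟨y, rfl⟩, hy⟩ := Metric.mem_closure_iff.1 hvp (ε / 2) (by positivity)
  have hlim : Tendsto (fun c : ℝ => 2 * ‖y‖ * ‖c‖⁻¹) (Bornology.cobounded ℝ) (𝓝 0) := by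
    simpa using (tendsto_inv_atTop_zero.comp (tendsto_norm_cobounded_atTop (E := ℝ))).const_mul
      (2 * ‖y‖)
  filter_upwards [(tendsto_order.1 hlim).2 (ε / 2) (by positivity),
    (tendsto_norm_cobounded_atTop (E := ℝ)).eventually_gt_atTop 0] with c hc hc0
  have hc1 : c ≠ 0 := norm_pos_iff.1 hc0
  have h1 : (x c - p + c⁻¹ • y) - c • T (x c - p + c⁻¹ • y) = (v - p - T y) + c⁻¹ • y := by
    have := hx c
    rw [map_add, map_sub, hp, map_smul, smul_add, smul_smul, mul_inv_cancel₀ hc1, ← this]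
    module
  have h2 := norm_le_of_sub_smul_skew hT h1
  have h3 : ‖c⁻¹ • y‖ = ‖y‖ * ‖c‖⁻¹ := by rw [norm_smul, norm_inv, mul_comm]
  rw [dist_eq_norm] at hy ⊢
  calc ‖x c - p‖ = ‖(x c - p + c⁻¹ • y) - c⁻¹ • y‖ := by rw [add_sub_cancel_right]
    _ ≤ ‖x c - p + c⁻¹ • y‖ + ‖c⁻¹ • y‖ := norm_sub_le _ _
    _ ≤ ‖v - p - T y‖ + ‖c⁻¹ • y‖ + ‖c⁻¹ • y‖ := by
      gcongr
      exact h2.trans (norm_add_le _ _)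
    _ < ε := by rw [h3]; linarith

end SkewAdjoint

/-- Completion of a real vector space with respect to a positive semidefinite form. -/
theorem exists_hilbert_completion.{u} {D : Type u} [AddCommGroup D] [Module ℝ D]
    (c : PreInnerProductSpace.Core ℝ D) :
    ∃ (V : Type u) (_ : NormedAddCommGroup V) (_ : InnerProductSpace ℝ V) (_ : CompleteSpace V)
      (j : D →ₗ[ℝ] V), DenseRange j ∧ ∀ f h, inner ℝ (j f) (j h) = c.inner f h := by
  -- The form may have null vectors, so it gives only a seminorm; the Hausdorff completion collapses
  -- them.
  let : SeminormedAddCommGroup D :=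
    @InnerProductSpace.Core.toSeminormedAddCommGroup ℝ D _ _ _ c
  let : InnerProductSpace ℝ D := InnerProductSpace.ofCore c
  refine ⟨UniformSpace.Completion D, inferInstance, inferInstance, inferInstance,
    (UniformSpace.Completion.toComplL (𝕜 := ℝ) (E := D)).toLinearMap,
    UniformSpace.Completion.denseRange_coe, fun f h => ?_⟩
  exact UniformSpace.Completion.inner_coe f h

/-! ### The Dirichlet form and its completion -/

section Analysis

variable (d : ℕ) {M : Type*} [TopologicalSpace M] [ChartedSpace (EuclideanSpace ℝ (Fin d)) M]
  [IsManifold (𝓡 d) ∞ M] [RiemannianBundle (fun x : M => TangentSpace (𝓡 d) x)]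

theorem inner_grad_right (f : M → ℝ) (x : M) (v : TangentSpace (𝓡 d) x) :
    inner ℝ (grad d f x) v = (mfderiv (𝓡 d) 𝓘(ℝ, ℝ) f x v : ℝ) :=
  InnerProductSpace.toDual_symm_apply

section Energy

variable [IsContMDiffRiemannianBundle (𝓡 d) ∞ (EuclideanSpace ℝ (Fin d))
    (fun x : M => TangentSpace (𝓡 d) x)]

theorem continuous_inner_grad_grad (f h : C^∞⟮𝓡 d, M; 𝓘(ℝ, ℝ), ℝ⟯) :
    Continuous fun x => (inner ℝ (grad d f x) (grad d h x) : ℝ) := by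
  have key : ∀ x, (inner ℝ (grad d f x) (grad d h x) : ℝ) =
      (‖grad d (⇑(f + h)) x‖ ^ 2 - ‖grad d f x‖ ^ 2 - ‖grad d h x‖ ^ 2) / 2 := by
    intro x
    rw [grad_add, norm_add_sq_real]
    ring
  simp only [key]
  exact ((((continuous_norm_grad d (f + h)).pow 2).sub ((continuous_norm_grad d f).pow 2)).sub
    ((continuous_norm_grad d h).pow 2)).div_const 2

variable [MeasurableSpace M] [BorelSpace M] [CompactSpace M] (μ : Measure M) [IsFiniteMeasure μ]

theorem integrable_inner_grad_grad (f h : C^∞⟮𝓡 d, M; 𝓘(ℝ, ℝ), ℝ⟯) :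
    Integrable (fun x => (inner ℝ (grad d f x) (grad d h x) : ℝ)) μ :=
  (continuous_inner_grad_grad d f h).integrable_of_hasCompactSupport
    (HasCompactSupport.of_compactSpace _)

theorem energy_comm (f h : C^∞⟮𝓡 d, M; 𝓘(ℝ, ℝ), ℝ⟯) : energy d μ f h = energy d μ h f := by
  unfold energy
  simp only [real_inner_comm]

theorem energy_add_left (f g h : C^∞⟮𝓡 d, M; 𝓘(ℝ, ℝ), ℝ⟯) :
    energy d μ (f + g) h = energy d μ f h + energy d μ g h := by
  unfold energy
  rw [← integral_add (integrable_inner_grad_grad d μ f h) (integrable_inner_grad_grad d μ g h)]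
  simp only [grad_add, inner_add_left]

theorem energy_smul_left (a : ℝ) (f h : C^∞⟮𝓡 d, M; 𝓘(ℝ, ℝ), ℝ⟯) :
    energy d μ (a • f) h = a * energy d μ f h := by
  unfold energy
  rw [← integral_const_mul]
  simp only [grad_smul, real_inner_smul_left]

/-- `V` is the Hilbert space `H¹` with the inner product `⟨·,·⟩_{1,lam}`, `j` the inclusion of the
smooth functions and `ι` the inclusion into `L²`. -/
structure IsFormModel (lam : ℝ) {V : Type*} [NormedAddCommGroup V] [InnerProductSpace ℝ V]
    (j : C^∞⟮𝓡 d, M; 𝓘(ℝ, ℝ), ℝ⟯ →ₗ[ℝ] V) (ι : V →L[ℝ] Lp ℝ 2 μ) : Prop where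
  denseRange : DenseRange j
  inner_apply : ∀ f h, inner ℝ (j f) (j h) =
    energy d μ f h + lam * inner ℝ (toL2 d μ f) (toL2 d μ h)
  apply : ∀ f, ι (j f) = toL2 d μ f
  injective : Function.Injective ι

/-- The inclusion of the smooth functions into `L²`, as a linear map. -/
noncomputable def toL2Linear : C^∞⟮𝓡 d, M; 𝓘(ℝ, ℝ), ℝ⟯ →ₗ[ℝ] Lp ℝ 2 μ where
  toFun := toL2 d μ
  map_add' := toL2_add d μ
  map_smul' := toL2_smul d μ

/-- The completion of the smooth functions always maps to L²; the point is that this map is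
injective, which is the closability of the form. It follows from Green's formula `hL`: ⟨j f, w⟩
depends on w only through ι w, so ι w = 0 makes w orthogonal to a dense set. -/
theorem exists_isFormModel.{u} {M : Type u} [TopologicalSpace M]
    [ChartedSpace (EuclideanSpace ℝ (Fin d)) M]
    [IsManifold (𝓡 d) ∞ M] [RiemannianBundle (fun x : M => TangentSpace (𝓡 d) x)]
    [IsContMDiffRiemannianBundle (𝓡 d) ∞ (EuclideanSpace ℝ (Fin d))
      (fun x : M => TangentSpace (𝓡 d) x)]
    [MeasurableSpace M] [BorelSpace M] [CompactSpace M] (μ : Measure M) [IsFiniteMeasure μ]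
    {lam : ℝ} (hlam : 0 < lam)
    (L : C^∞⟮𝓡 d, M; 𝓘(ℝ, ℝ), ℝ⟯ → Lp ℝ 2 μ)
    (hL : ∀ f h, energy d μ f h = -inner ℝ (L f) (toL2 d μ h)) :
    ∃ (V : Type u) (_ : NormedAddCommGroup V) (_ : InnerProductSpace ℝ V) (_ : CompleteSpace V)
      (j : C^∞⟮𝓡 d, M; 𝓘(ℝ, ℝ), ℝ⟯ →ₗ[ℝ] V) (ι : V →L[ℝ] Lp ℝ 2 μ),
      IsFormModel d μ lam j ι := by
  obtain ⟨V, _, _, _, j, hj, hin⟩ := exists_hilbert_completion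
    (D := C^∞⟮𝓡 d, M; 𝓘(ℝ, ℝ), ℝ⟯)
    { inner := fun f h => energy d μ f h + lam * inner ℝ (toL2 d μ f) (toL2 d μ h)
      conj_inner_symm := fun f h => by
        simp [energy_comm d μ h f, real_inner_comm]
      re_inner_nonneg := fun f => by
        have h1 := energy_self_nonneg d μ f
        have h2 : (0 : ℝ) ≤ inner ℝ (toL2 d μ f) (toL2 d μ f) := real_inner_self_nonneg
        simp only [RCLike.re_to_real]
        positivity
      add_left := fun f g h => by
        rw [energy_add_left, toL2_add, inner_add_left]
        ring
      smul_left := fun f h a => by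
        rw [energy_smul_left, toL2_smul, real_inner_smul_left]
        simp
        ring }
  have hin' : ∀ f h, inner ℝ (j f) (j h) =
    energy d μ f h + lam * inner ℝ (toL2 d μ f) (toL2 d μ h) := hin
  -- The energy is nonnegative, so lam‖f‖² ≤ ‖j f‖².
  have hnorm : ∀ f, ‖toL2Linear d μ f‖ ≤ (√lam)⁻¹ * ‖j f‖ := by
    intro f
    rw [inv_mul_eq_div, le_div_iff₀ (Real.sqrt_pos.2 hlam)]
    refine le_of_sq_le_sq ?_ (norm_nonneg _)
    rw [mul_pow, Real.sq_sqrt hlam.le, ← real_inner_self_eq_norm_sq, ← real_inner_self_eq_norm_sq,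
      hin']
    have h1 := energy_self_nonneg d μ f
    change inner ℝ (toL2 d μ f) (toL2 d μ f) * lam ≤ _
    linarith
  let ι : V →L[ℝ] Lp ℝ 2 μ := (toL2Linear d μ).extendOfNorm j
  have hι : ∀ f, ι (j f) = toL2 d μ f := fun f =>
    LinearMap.extendOfNorm_eq hj ⟨_, hnorm⟩ f
  refine ⟨V, inferInstance, inferInstance, inferInstance, j, ι, hj, hin', hι, ?_⟩
  rw [injective_iff_map_eq_zero]
  intro v hv
  have key : ∀ (f : C^∞⟮𝓡 d, M; 𝓘(ℝ, ℝ), ℝ⟯) (w : V),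
      inner ℝ (j f) w = inner ℝ (-L f + lam • toL2 d μ f) (ι w) := by
    intro f w
    refine hj.induction_on w (isClosed_eq (by fun_prop) (by fun_prop)) fun h => ?_
    rw [hin', hL, hι, inner_add_left, inner_neg_left, real_inner_smul_left]
  refine hj.eq_zero_of_inner_right ℝ fun f => ?_
  rw [key, hv, inner_zero_right]

end Energy

end Analysis

/-! ### Sobolev space, drift and projection expressed in the Hilbert space `V` -/

section FormModel

variable {d : ℕ} {M : Type*} [TopologicalSpace M] [ChartedSpace (EuclideanSpace ℝ (Fin d)) M]
  [IsManifold (𝓡 d) ∞ M] [RiemannianBundle (fun x : M => TangentSpace (𝓡 d) x)]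
  [IsContMDiffRiemannianBundle (𝓡 d) ∞ (EuclideanSpace ℝ (Fin d))
    (fun x : M => TangentSpace (𝓡 d) x)]
  [MeasurableSpace M] [BorelSpace M] [CompactSpace M] {μ : Measure M} [IsFiniteMeasure μ]
  {lam : ℝ} {V : Type*} [NormedAddCommGroup V] [InnerProductSpace ℝ V]
  {j : C^∞⟮𝓡 d, M; 𝓘(ℝ, ℝ), ℝ⟯ →ₗ[ℝ] V} {ι : V →L[ℝ] Lp ℝ 2 μ}

namespace IsFormModel

/-- Energy differences and L² differences together control differences in `V`, and conversely. Hence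
the sequences of `IsH1Limit` are the sequences of smooth functions that converge in `V`. -/
theorem energy_self (hm : IsFormModel d μ lam j ι) (f h : C^∞⟮𝓡 d, M; 𝓘(ℝ, ℝ), ℝ⟯) :
    energy d μ (f - h) (f - h) =
      ‖j f - j h‖ ^ 2 - lam * ‖toL2 d μ f - toL2 d μ h‖ ^ 2 := by
  rw [← map_sub, ← real_inner_self_eq_norm_sq, hm.inner_apply, ← hm.apply f, ← hm.apply h,
    ← map_sub, ← map_sub, hm.apply, real_inner_self_eq_norm_sq]
  ring

theorem exists_tendsto [CompleteSpace V] (hm : IsFormModel d μ lam j ι)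
    {f : ℕ → C^∞⟮𝓡 d, M; 𝓘(ℝ, ℝ), ℝ⟯} {u : Lp ℝ 2 μ} (hf : IsH1Limit d μ f u) :
    ∃ v, ι v = u ∧ Tendsto (fun n => j (f n)) atTop (𝓝 v) := by
  have hc : CauchySeq fun n => j (f n) := by
    rw [cauchySeq_iff_tendsto_dist_atTop_0]
    have h1 : Tendsto (fun p : ℕ × ℕ => ‖toL2 d μ (f p.1) - toL2 d μ (f p.2)‖ ^ 2)
        atTop (𝓝 0) := by
      have := (cauchySeq_iff_tendsto_dist_atTop_0.1 hf.1.cauchySeq).pow 2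
      simpa [dist_eq_norm] using this
    have h2 := (hf.2.add (h1.const_mul lam)).sqrt
    simp only [mul_zero, add_zero, Real.sqrt_zero] at h2
    refine h2.congr fun p => ?_
    rw [hm.energy_self, sub_add_cancel, Real.sqrt_sq (norm_nonneg _), dist_eq_norm]
  obtain ⟨v, hv⟩ := cauchySeq_tendsto_of_complete hc
  refine ⟨v, ?_, hv⟩
  have h1 := (ι.continuous.tendsto v).comp hv
  simp only [Function.comp_def, hm.apply] at h1
  exact tendsto_nhds_unique h1 hf.1

theorem isH1Limit (hm : IsFormModel d μ lam j ι)
    {f : ℕ → C^∞⟮𝓡 d, M; 𝓘(ℝ, ℝ), ℝ⟯} {v : V} (hf : Tendsto (fun n => j (f n)) atTop (𝓝 v)) :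
    IsH1Limit d μ f (ι v) := by
  have h1 : Tendsto (fun n => toL2 d μ (f n)) atTop (𝓝 (ι v)) := by
    have := (ι.continuous.tendsto v).comp hf
    simpa only [Function.comp_def, hm.apply] using this
  refine ⟨h1, ?_⟩
  have h2 := (cauchySeq_iff_tendsto_dist_atTop_0.1 hf.cauchySeq).pow 2
  have h3 := ((cauchySeq_iff_tendsto_dist_atTop_0.1 h1.cauchySeq).pow 2).const_mul lam
  have h4 := h2.sub h3
  simp only [ne_eq, OfNat.ofNat_ne_zero, not_false_eq_true, zero_pow, mul_zero, sub_zero,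
    dist_eq_norm] at h4
  exact h4.congr fun p => (hm.energy_self _ _).symm

theorem exists_seq (hm : IsFormModel d μ lam j ι) (v : V) :
    ∃ f : ℕ → C^∞⟮𝓡 d, M; 𝓘(ℝ, ℝ), ℝ⟯, Tendsto (fun n => j (f n)) atTop (𝓝 v) := by
  obtain ⟨x, hx, hxv⟩ := mem_closure_iff_seq_limit.1 (hm.denseRange v)
  choose f hf using hx
  exact ⟨f, by simpa only [hf] using hxv⟩

theorem mem_sobolevH1 [CompleteSpace V] (hm : IsFormModel d μ lam j ι) {u : Lp ℝ 2 μ} :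
    u ∈ sobolevH1 d μ ↔ ∃ v, ι v = u := by
  constructor
  · rintro ⟨f, hf⟩
    obtain ⟨v, hv, -⟩ := hm.exists_tendsto hf
    exact ⟨v, hv⟩
  · rintro ⟨v, rfl⟩
    obtain ⟨f, hf⟩ := hm.exists_seq v
    exact ⟨f, hm.isH1Limit hf⟩

/-- The sequence is an arbitrary choice. It converges in `V` to some preimage of ι v, and
injectivity of ι makes this preimage v. The limits that define `innerH1` therefore exist and do not
depend on the choice. -/
theorem tendsto_h1Seq [CompleteSpace V] (hm : IsFormModel d μ lam j ι) (v : V) :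
    Tendsto (fun n => j (h1Seq d μ (ι v) n)) atTop (𝓝 v) := by
  have h : ∃ f, IsH1Limit d μ f (ι v) := hm.mem_sobolevH1.2 ⟨v, rfl⟩
  obtain ⟨w, hw, hlim⟩ := hm.exists_tendsto h.choose_spec
  rw [hm.injective hw] at hlim
  simpa only [h1Seq, dif_pos h] using hlim

theorem innerH1_apply [CompleteSpace V] (hm : IsFormModel d μ lam j ι) (v w : V) :
    innerH1 d μ (ι v) (ι w) = inner ℝ v w - lam * inner ℝ (ι v) (ι w) := by
  have hv := hm.tendsto_h1Seq v
  have hw := hm.tendsto_h1Seq w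
  have h1 := (hv.inner hw).sub ((((ι.continuous.tendsto v).comp hv).inner
    ((ι.continuous.tendsto w).comp hw)).const_mul lam)
  refine Tendsto.limUnder_eq (h1.congr fun n => ?_)
  simp only [Function.comp_apply, hm.apply, hm.inner_apply]
  ring

theorem innerH1Shift_apply [CompleteSpace V] (hm : IsFormModel d μ lam j ι) (v w : V) :
    innerH1Shift d μ lam (ι v) (ι w) = inner ℝ v w := by
  rw [innerH1Shift, hm.innerH1_apply, sub_add_cancel]

theorem normH1_apply [CompleteSpace V] (hm : IsFormModel d μ lam j ι) (v : V) :
    normH1 d μ (ι v) = √(‖v‖ ^ 2 + (1 - lam) * ‖ι v‖ ^ 2) := by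
  rw [normH1, hm.innerH1_apply, real_inner_self_eq_norm_sq, real_inner_self_eq_norm_sq]
  congr 1
  ring

/-- The two Sobolev norms differ by (1 - lam)‖ι v‖² under the root. This is continuous on `V`,
whatever the sign of 1 - lam. -/
theorem tendsto_normH1 [CompleteSpace V] (hm : IsFormModel d μ lam j ι) {α : Type*}
    {l : Filter α} {x : α → V} {p : V} (hx : Tendsto x l (𝓝 p)) :
    Tendsto (fun c => normH1 d μ (ι (x c) - ι p)) l (𝓝 0) := by
  have h1 : Continuous fun v : V => √(‖v - p‖ ^ 2 + (1 - lam) * ‖ι (v - p)‖ ^ 2) := by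
    fun_prop
  have h2 := (h1.tendsto p).comp hx
  simp only [sub_self, map_zero, norm_zero] at h2
  simp only [← map_sub, hm.normH1_apply]
  simpa [Function.comp_def] using h2

/-! #### The drift operator -/

variable {b : (x : M) → TangentSpace (𝓡 d) x} {Bt : V →L[ℝ] Lp ℝ 2 μ}

/-- Boundedness of `Bt` on `V` makes the limit of b·∇(f n) independent of the approximating
sequence. -/
theorem mem_driftGraph [CompleteSpace V] (hm : IsFormModel d μ lam j ι)
    (hB : ∀ f, Bt (j f) =ᵐ[μ] fun x => inner ℝ (b x) (grad d f x)) (p : Lp ℝ 2 μ × Lp ℝ 2 μ) :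
    p ∈ driftGraph d μ b ↔ ∃ v, ι v = p.1 ∧ Bt v = p.2 := by
  constructor
  · rintro ⟨f, hf, w, hw, hwl⟩
    obtain ⟨v, hv, hlim⟩ := hm.exists_tendsto hf
    refine ⟨v, hv, tendsto_nhds_unique ((Bt.continuous.tendsto v).comp hlim) (hwl.congr ?_)⟩
    intro n
    exact Lp.ext ((hw n).trans (hB (f n)).symm)
  · rintro ⟨v, hv, hv'⟩
    obtain ⟨f, hf⟩ := hm.exists_seq v
    refine ⟨f, hv ▸ hm.isH1Limit hf, fun n => Bt (j (f n)), fun n => hB _, ?_⟩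
    rw [← hv']
    exact (Bt.continuous.tendsto v).comp hf

theorem mem_graph_driftOp [CompleteSpace V] (hm : IsFormModel d μ lam j ι)
    (hB : ∀ f, Bt (j f) =ᵐ[μ] fun x => inner ℝ (b x) (grad d f x)) (x y : Lp ℝ 2 μ) :
    (x, y) ∈ (driftOp d μ b).graph ↔ ∃ v, ι v = x ∧ Bt v = y := by
  rw [driftOp, Submodule.toLinearPMap_graph_eq, hm.mem_driftGraph hB]
  -- The graph is single-valued, because ι v = 0 forces v = 0 and hence `Bt` v = 0.
  intro p hp h0
  obtain ⟨v, hv, hv'⟩ := (hm.mem_driftGraph hB p).1 hp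
  rw [h0, map_eq_zero_iff ι hm.injective] at hv
  rw [← hv', hv, map_zero]

theorem mem_driftKer [CompleteSpace V] (hm : IsFormModel d μ lam j ι)
    (hB : ∀ f, Bt (j f) =ᵐ[μ] fun x => inner ℝ (b x) (grad d f x)) (u : Lp ℝ 2 μ) :
    u ∈ driftKer d μ b ↔ ∃ v, ι v = u ∧ Bt v = 0 := by
  have h1 : u ∈ (LinearMap.ker (driftOp d μ b).toFun).map (driftOp d μ b).domain.subtype ↔
      (u, 0) ∈ (driftOp d μ b).graph := by
    rw [LinearPMap.mem_graph_iff, Submodule.mem_map]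
    constructor
    · rintro ⟨y, hy, rfl⟩
      exact ⟨y, rfl, hy⟩
    · rintro ⟨y, hy, hy'⟩
      exact ⟨y, hy', hy⟩
  rw [driftKer, Submodule.mem_inf, h1, hm.mem_graph_driftOp hB, and_iff_right_iff_imp]
  rintro ⟨v, hv, -⟩
  exact hm.mem_sobolevH1.2 ⟨v, hv⟩

theorem isKerProj_iff [CompleteSpace V] (hm : IsFormModel d μ lam j ι)
    (hB : ∀ f, Bt (j f) =ᵐ[μ] fun x => inner ℝ (b x) (grad d f x)) (u : V) (q : Lp ℝ 2 μ) :
    IsKerProj d μ b lam (ι u) q ↔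
      ∃ p, ι p = q ∧ Bt p = 0 ∧ ∀ k, Bt k = 0 → inner ℝ (u - p) k = 0 := by
  constructor
  · rintro ⟨hq, hq'⟩
    obtain ⟨p, rfl, hp⟩ := (hm.mem_driftKer hB q).1 hq
    refine ⟨p, rfl, hp, fun k hk => ?_⟩
    rw [← hm.innerH1Shift_apply, map_sub]
    exact hq' _ ((hm.mem_driftKer hB _).2 ⟨k, rfl, hk⟩)
  · rintro ⟨p, rfl, hp, hp'⟩
    refine ⟨(hm.mem_driftKer hB _).2 ⟨p, rfl, hp⟩, fun k hk => ?_⟩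
    obtain ⟨k, rfl, hk'⟩ := (hm.mem_driftKer hB _).1 hk
    rw [← map_sub, hm.innerH1Shift_apply]
    exact hp' k hk'

/-- `Bt` is continuous on `V`, so its kernel is closed there and the Hilbert space projection
exists. -/
theorem existsUnique_isKerProj [CompleteSpace V] (hm : IsFormModel d μ lam j ι)
    (hB : ∀ f, Bt (j f) =ᵐ[μ] fun x => inner ℝ (b x) (grad d f x)) (u : V) :
    ∃! q, IsKerProj d μ b lam (ι u) q := by
  have hK : IsClosed ((LinearMap.ker Bt.toLinearMap : Submodule ℝ V) : Set V) :=
    ContinuousLinearMap.isClosed_ker Bt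
  have : CompleteSpace (LinearMap.ker Bt.toLinearMap) := hK.completeSpace_coe
  obtain ⟨p, hp, hp'⟩ :=
    Submodule.HasOrthogonalProjection.exists_orthogonal (K := LinearMap.ker Bt.toLinearMap) u
  have hp1 : ∀ k, Bt k = 0 → inner ℝ (u - p) k = 0 := fun k hk =>
    (Submodule.mem_orthogonal' _ _).1 hp' k hk
  refine ⟨ι p, (hm.isKerProj_iff hB u _).2 ⟨p, rfl, hp, hp1⟩, fun q hq => ?_⟩
  obtain ⟨r, rfl, hr, hr1⟩ := (hm.isKerProj_iff hB u _).1 hq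
  congr 1
  have hrp : Bt (r - p) = 0 := by
    have hp : Bt p = 0 := hp
    rw [map_sub, hr, hp, sub_zero]
  have h1 := hr1 _ hrp
  have h2 := hp1 _ hrp
  -- The difference r - p lies in the kernel and is also a difference of two vectors orthogonal to
  -- the kernel.
  rw [← sub_eq_zero, ← inner_self_eq_zero (𝕜 := ℝ)]
  have : r - p = (u - p) - (u - r) := by abel
  nth_rewrite 1 [this]
  rw [inner_sub_left, h1, h2, sub_zero]

end IsFormModel

/-! #### Bounded inverses -/

theorem IsShiftInverse.eq {H : Type*} [NormedAddCommGroup H] [InnerProductSpace ℝ H]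
    {T : H →ₗ.[ℝ] H} {S S' : H →L[ℝ] H} (h : IsShiftInverse T lam S)
    (h' : IsShiftInverse T lam S') : S = S' := by
  ext1 g
  obtain ⟨h1, h2⟩ := h.1 g
  have h3 := h'.2 ⟨S g, h1⟩
  rw [h2] at h3
  exact h3.symm

theorem IsShiftInverse.shiftInverse_eq {H : Type*} [NormedAddCommGroup H] [InnerProductSpace ℝ H]
    {T : H →ₗ.[ℝ] H} {S : H →L[ℝ] H} (h : IsShiftInverse T lam S) : shiftInverse T lam = S := by
  have h1 : ∃ S : H →L[ℝ] H, IsShiftInverse T lam S := ⟨S, h⟩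
  rw [shiftInverse, dif_pos h1]
  exact h1.choose_spec.eq h

/-- If the graph of `T` is given by the equation `(1 - Q) v = J (lam - T) (ι v)`, where `1 - Q` is
invertible, then `T - lam` has the bounded inverse `-ι (1 - Q)⁻¹ J`. -/
theorem isShiftInverse_of_graph {H : Type*} [NormedAddCommGroup H] [InnerProductSpace ℝ H]
    {T : H →ₗ.[ℝ] H} {ι : V →L[ℝ] H} {J : H →L[ℝ] V} {R Q : V →L[ℝ] V}
    (hT : ∀ x y, (x, y) ∈ T.graph ↔ ∃ v, ι v = x ∧ v - Q v = J (lam • x - y))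
    (hR : ∀ v, R v - Q (R v) = v) (hR' : ∀ v, R (v - Q v) = v) :
    IsShiftInverse T lam (-(ι ∘L R ∘L J)) := by
  constructor
  · intro g
    -- A pair (x, g + lam x) in the graph means (T - lam)x = g.
    have h1 : (-(ι (R (J g))), g + lam • -(ι (R (J g)))) ∈ T.graph := by
      rw [hT]
      refine ⟨-(R (J g)), by simp, ?_⟩
      have h2 := hR (J g)
      have h3 : lam • -(ι (R (J g))) - (g + lam • -(ι (R (J g)))) = -g := by abel
      rw [h3, map_neg, map_neg, neg_sub_neg, ← neg_sub, h2]
    obtain ⟨⟨y, hy'⟩, hy, h2⟩ := (LinearPMap.mem_graph_iff _).1 h1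
    simp only at hy
    subst hy
    refine ⟨hy', ?_⟩
    change T ⟨-(ι (R (J g))), _⟩ - lam • -(ι (R (J g))) = g
    rw [h2]
    simp
  · intro ψ
    obtain ⟨v, hv, h⟩ := (hT _ _).1 (T.mem_graph ψ)
    have h1 : J (T ψ - lam • (ψ : H)) = -(v - Q v) := by rw [h, ← map_neg, neg_sub]
    simp only [neg_apply, ContinuousLinearMap.comp_apply]
    rw [h1, map_neg, hR', map_neg, neg_neg, hv]

end FormModel

/-! ### The operators `A` and `A + cB` as bounded equations on `V` -/

section Reduction

variable {d : ℕ} {M : Type*} [TopologicalSpace M] [ChartedSpace (EuclideanSpace ℝ (Fin d)) M]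
  [IsManifold (𝓡 d) ∞ M] [RiemannianBundle (fun x : M => TangentSpace (𝓡 d) x)]
  [IsContMDiffRiemannianBundle (𝓡 d) ∞ (EuclideanSpace ℝ (Fin d))
    (fun x : M => TangentSpace (𝓡 d) x)]
  [MeasurableSpace M] [BorelSpace M] [CompactSpace M]

theorem norm_toL2_sq (μ : Measure M) [IsFiniteMeasure μ] (f : C(M, ℝ)) :
    ‖ContinuousMap.toLp (E := ℝ) 2 μ ℝ f‖ ^ 2 = ∫ x, f x ^ 2 ∂μ := by
  rw [← real_inner_self_eq_norm_sq, MeasureTheory.L2.inner_def]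
  refine integral_congr_ae ?_
  filter_upwards [ContinuousMap.coeFn_toLp (𝕜 := ℝ) (p := 2) μ f] with x hx
  rw [hx, real_inner_self_eq_norm_sq, Real.norm_eq_abs, sq_abs]

theorem inner_toL2 (μ : Measure M) [IsFiniteMeasure μ] (u : Lp ℝ 2 μ) (k : M → ℝ)
    (hu : u =ᵐ[μ] k) (f : C^∞⟮𝓡 d, M; 𝓘(ℝ, ℝ), ℝ⟯) :
    inner ℝ u (toL2 d μ f) = ∫ x, k x * f x ∂μ := by
  rw [MeasureTheory.L2.inner_def]
  refine integral_congr_ae ?_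
  filter_upwards [ContinuousMap.coeFn_toLp (𝕜 := ℝ) (p := 2) μ
    (⟨f, f.contMDiff.continuous⟩ : C(M, ℝ)), hu] with x hx hx'
  rw [toL2, hx, hx']
  simp [mul_comm]

section Drift

variable {μ : Measure M} [IsFiniteMeasure μ]
  {lam : ℝ} {V : Type*} [NormedAddCommGroup V] [InnerProductSpace ℝ V]
  {j : C^∞⟮𝓡 d, M; 𝓘(ℝ, ℝ), ℝ⟯ →ₗ[ℝ] V} {ι : V →L[ℝ] Lp ℝ 2 μ}
  {b : (x : M) → TangentSpace (𝓡 d) x}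

/-- By Cauchy–Schwarz the L² norm of b·∇f is at most |C| times the root of the energy of f, hence at
most |C| ‖j f‖. Density of the smooth functions gives the extension. -/
theorem IsFormModel.exists_driftExtension (hm : IsFormModel d μ lam j ι) (hlam : 0 < lam)
    (hbc : ∀ f : C^∞⟮𝓡 d, M; 𝓘(ℝ, ℝ), ℝ⟯,
      Continuous fun x => (inner ℝ (b x) (grad d f x) : ℝ))
    {C : ℝ} (hC : ∀ x, ‖b x‖ ≤ C) :
    ∃ Bt : V →L[ℝ] Lp ℝ 2 μ, ∀ f, Bt (j f) =ᵐ[μ] fun x => inner ℝ (b x) (grad d f x) := by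
  let Bo : C^∞⟮𝓡 d, M; 𝓘(ℝ, ℝ), ℝ⟯ →ₗ[ℝ] Lp ℝ 2 μ :=
    { toFun := fun f => ContinuousMap.toLp (E := ℝ) 2 μ ℝ ⟨_, hbc f⟩
      map_add' := fun f h => by
        rw [← map_add]
        congr 1
        ext x
        simp only [ContinuousMap.coe_mk, ContinuousMap.add_apply, grad_add, inner_add_right]
      map_smul' := fun a f => by
        rw [RingHom.id_apply, ← map_smul]
        congr 1
        ext x
        simp only [ContinuousMap.coe_mk, ContinuousMap.smul_apply, grad_smul,
          real_inner_smul_right, smul_eq_mul] }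
  -- On an empty manifold `C` may be negative.
  have hC' : ∀ x, ‖b x‖ ≤ |C| := fun x => (hC x).trans (le_abs_self C)
  have hbound : ∀ f, ‖Bo f‖ ≤ |C| * ‖j f‖ := by
    intro f
    refine le_of_sq_le_sq ?_ (by positivity)
    rw [mul_pow, ← real_inner_self_eq_norm_sq (j f), hm.inner_apply]
    have h1 : ‖Bo f‖ ^ 2 ≤ |C| ^ 2 * energy d μ f f := by
      change ‖ContinuousMap.toLp (E := ℝ) 2 μ ℝ _‖ ^ 2 ≤ _
      rw [norm_toL2_sq, energy, ← integral_const_mul]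
      refine integral_mono
        (((hbc f).pow 2).integrable_of_hasCompactSupport (HasCompactSupport.of_compactSpace _))
        ((integrable_inner_grad_grad d μ f f).const_mul _) fun x => ?_
      simp only [ContinuousMap.coe_mk]
      rw [real_inner_self_eq_norm_sq, ← mul_pow]
      refine sq_le_sq' ?_ ?_
      · refine (neg_le_neg ?_).trans (neg_le_of_abs_le (abs_real_inner_le_norm _ _))
        gcongr
        exact hC' x
      · refine (real_inner_le_norm _ _).trans ?_
        gcongr
        exact hC' x
    refine h1.trans ?_
    have h2 : (0 : ℝ) ≤ inner ℝ (toL2 d μ f) (toL2 d μ f) := real_inner_self_nonneg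
    gcongr
    exact le_add_of_nonneg_right (by positivity)
  refine ⟨Bo.extendOfNorm j, fun f => ?_⟩
  rw [LinearMap.extendOfNorm_eq hm.denseRange ⟨_, hbound⟩ f]
  exact ContinuousMap.coeFn_toLp (𝕜 := ℝ) (p := 2) μ _

theorem IsFormModel.driftExtension_skew (hm : IsFormModel d μ lam j ι)
    {Bt : V →L[ℝ] Lp ℝ 2 μ} (hB : ∀ f, Bt (j f) =ᵐ[μ] fun x => inner ℝ (b x) (grad d f x))
    (hskew : ∀ f h : C^∞⟮𝓡 d, M; 𝓘(ℝ, ℝ), ℝ⟯, ∫ x, inner ℝ (b x) (grad d f x) * h x ∂μ =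
      -∫ x, inner ℝ (b x) (grad d h x) * f x ∂μ) (v w : V) :
    inner ℝ (Bt v) (ι w) = -inner ℝ (ι v) (Bt w) := by
  refine hm.denseRange.induction_on₂ (p := fun v w => inner ℝ (Bt v) (ι w) =
    -inner ℝ (ι v) (Bt w)) (isClosed_eq (by fun_prop) (by fun_prop)) (fun f h => ?_) v w
  rw [hm.apply, hm.apply, real_inner_comm (Bt (j h)), inner_toL2 μ _ _ (hB h),
    inner_toL2 μ _ _ (hB f)]
  exact hskew f h

end Drift

section Generator

variable {U : M → ℝ} [IsFiniteMeasure (gibbs d U)] {lam : ℝ} {V : Type*} [NormedAddCommGroup V]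
  [InnerProductSpace ℝ V] [CompleteSpace V] {j : C^∞⟮𝓡 d, M; 𝓘(ℝ, ℝ), ℝ⟯ →ₗ[ℝ] V}
  {ι : V →L[ℝ] Lp ℝ 2 (gibbs d U)}

/-- By Green's formula, the adjoint relation ⟨x, A_o f⟩ = ⟨y, f⟩ for x in H¹ is the weak equation
⟨x, f⟩_{1,lam} = ⟨lam x - y, f⟩. The right-hand side is represented in `V` by ι*(lam x - y), and
smooth f are dense in `V`. -/
theorem IsFormModel.mem_graph_generator (hm : IsFormModel d (gibbs d U) lam j ι)
    {L : C^∞⟮𝓡 d, M; 𝓘(ℝ, ℝ), ℝ⟯ → Lp ℝ 2 (gibbs d U)}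
    (hLc : ∀ f, L f =ᵐ[gibbs d U] coreOp d U f)
    (hL : ∀ f h, energy d (gibbs d U) f h = -inner ℝ (L f) (toL2 d (gibbs d U) h))
    (hd : DenseRange (toL2 d (gibbs d U))) (x y : Lp ℝ 2 (gibbs d U)) :
    (x, y) ∈ (generator d U).graph ↔ ∃ v, ι v = x ∧ v = ι.adjoint (lam • x - y) := by
  have key : ∀ v f, inner ℝ v (j f) =
      -inner ℝ (ι v) (L f) + lam * inner ℝ (ι v) (toL2 d (gibbs d U) f) := by
    intro v f
    refine hm.denseRange.induction_on v (isClosed_eq (by fun_prop) (by fun_prop)) fun h => ?_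
    rw [real_inner_comm, hm.inner_apply, hL, hm.apply, real_inner_comm (L f),
      real_inner_comm (toL2 d (gibbs d U) f)]
  have hgraph : ∀ p, p ∈ generatorGraph d U ↔
      ∃ v, ι v = p.1 ∧ v = ι.adjoint (lam • p.1 - p.2) := by
    rintro ⟨x, y⟩
    constructor
    · rintro ⟨h1, h2⟩
      obtain ⟨v, rfl⟩ := hm.mem_sobolevH1.1 h1
      refine ⟨v, rfl, hm.denseRange.eq_of_inner_left ℝ fun f => ?_⟩
      rw [ContinuousLinearMap.adjoint_inner_left, key, hm.apply, inner_sub_left,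
        real_inner_smul_left]
      have := h2 f (L f) (hLc f)
      simp only at this
      rw [this]
      ring
    · rintro ⟨v, rfl, hv⟩
      refine ⟨hm.mem_sobolevH1.2 ⟨v, rfl⟩, fun f w hw => ?_⟩
      have hwL : w = L f := Lp.ext (hw.trans (hLc f).symm)
      have h1 := key v f
      nth_rewrite 1 [hv] at h1
      rw [ContinuousLinearMap.adjoint_inner_left, hm.apply, inner_sub_left,
        real_inner_smul_left] at h1
      simp only at h1 ⊢
      rw [hwL]
      linarith
  rw [generator, Submodule.toLinearPMap_graph_eq, hgraph]
  -- The graph is single-valued: x = 0 gives ι*y = 0, so y is orthogonal to all smooth functions,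
  -- which are dense in L².
  intro p hp h0
  obtain ⟨v, hv, hv'⟩ := (hgraph p).1 hp
  rw [h0, map_eq_zero_iff ι hm.injective] at hv
  rw [h0, hv, smul_zero, zero_sub, map_neg, eq_comm, neg_eq_zero] at hv'
  refine hd.eq_zero_of_inner_left ℝ fun f => ?_
  rw [← hm.apply, ← ContinuousLinearMap.adjoint_inner_left, hv', inner_zero_left]

/-- In `mem_graph_generator` the value of A at x is y - cBx; moving the drift term to the left
produces c ι*B. Every x in the domain of A lies in H¹, so the sum keeps the domain of A. -/
theorem IsFormModel.mem_graph_driftGenerator (hm : IsFormModel d (gibbs d U) lam j ι)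
    {L : C^∞⟮𝓡 d, M; 𝓘(ℝ, ℝ), ℝ⟯ → Lp ℝ 2 (gibbs d U)}
    (hLc : ∀ f, L f =ᵐ[gibbs d U] coreOp d U f)
    (hL : ∀ f h, energy d (gibbs d U) f h = -inner ℝ (L f) (toL2 d (gibbs d U) h))
    (hd : DenseRange (toL2 d (gibbs d U))) {b : (x : M) → TangentSpace (𝓡 d) x}
    {Bt : V →L[ℝ] Lp ℝ 2 (gibbs d U)}
    (hB : ∀ f, Bt (j f) =ᵐ[gibbs d U] fun x => inner ℝ (b x) (grad d f x)) (c : ℝ)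
    (x y : Lp ℝ 2 (gibbs d U)) :
    (x, y) ∈ (driftGenerator d U b c).graph ↔
      ∃ v, ι v = x ∧ v - (c • (ι.adjoint ∘L Bt)) v = ι.adjoint (lam • x - y) := by
  rw [LinearPMap.mem_graph_iff]
  constructor
  · rintro ⟨⟨z, hz, hz'⟩, rfl, rfl⟩
    obtain ⟨v, hv, hv'⟩ := (hm.mem_graph_generator hLc hL hd _ _).1
      ((generator d U).mem_graph ⟨z, hz⟩)
    obtain ⟨w, hw, hw'⟩ := (hm.mem_graph_driftOp hB _ _).1
      ((driftOp d (gibbs d U) b).mem_graph ⟨z, hz'⟩)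
    obtain rfl : w = v := hm.injective (hw.trans hv.symm)
    refine ⟨w, hv, ?_⟩
    have h1 : driftGenerator d U b c ⟨z, hz, hz'⟩ = generator d U ⟨z, hz⟩ + c • Bt w := by
      rw [hw']
      rfl
    rw [h1, ← sub_sub, map_sub, map_smul, ← hv']
    rfl
  · rintro ⟨v, rfl, hv⟩
    have h1 : (ι v, y - c • Bt v) ∈ (generator d U).graph := by
      refine (hm.mem_graph_generator hLc hL hd _ _).2 ⟨v, rfl, ?_⟩
      rw [sub_sub_eq_add_sub, add_sub_right_comm, map_add, ← hv, map_smul]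
      simp
    have h2 : (ι v, Bt v) ∈ (driftOp d (gibbs d U) b).graph :=
      (hm.mem_graph_driftOp hB _ _).2 ⟨v, rfl, rfl⟩
    obtain ⟨⟨z, hz⟩, rfl, h3⟩ := (LinearPMap.mem_graph_iff _).1 h1
    obtain ⟨⟨z', hz'⟩, h5, h4⟩ := (LinearPMap.mem_graph_iff _).1 h2
    simp only at h3 h4 h5
    subst h5
    refine ⟨⟨_, hz, hz'⟩, rfl, ?_⟩
    change generator d U ⟨_, hz⟩ + c • driftOp d (gibbs d U) b ⟨_, hz'⟩ = y
    rw [h3, h4]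
    simp

end Generator

end Reduction

/-- The convergence theorem, deduced from the integration by parts formulas and the density of
the smooth functions in `L²`. -/
theorem resolvent_limit_of_integration_by_parts {d : ℕ} {M : Type*} [TopologicalSpace M]
    [CompactSpace M] [ChartedSpace (EuclideanSpace ℝ (Fin d)) M] [IsManifold (𝓡 d) ∞ M]
    [RiemannianBundle (fun x : M => TangentSpace (𝓡 d) x)]
    [IsContMDiffRiemannianBundle (𝓡 d) ∞ (EuclideanSpace ℝ (Fin d))
      (fun x : M => TangentSpace (𝓡 d) x)]
    [MeasurableSpace M] [BorelSpace M]
    (U : M → ℝ) [IsFiniteMeasure (gibbs d U)] (b : (x : M) → TangentSpace (𝓡 d) x)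
    {L : C^∞⟮𝓡 d, M; 𝓘(ℝ, ℝ), ℝ⟯ → Lp ℝ 2 (gibbs d U)}
    (hLc : ∀ f, L f =ᵐ[gibbs d U] coreOp d U f)
    (hL : ∀ f h, energy d (gibbs d U) f h = -inner ℝ (L f) (toL2 d (gibbs d U) h))
    (hd : DenseRange (toL2 d (gibbs d U)))
    (hbc : ∀ f : C^∞⟮𝓡 d, M; 𝓘(ℝ, ℝ), ℝ⟯,
      Continuous fun x => (inner ℝ (b x) (grad d f x) : ℝ))
    {C : ℝ} (hC : ∀ x, ‖b x‖ ≤ C)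
    (hskew : ∀ f h : C^∞⟮𝓡 d, M; 𝓘(ℝ, ℝ), ℝ⟯,
      ∫ x, inner ℝ (b x) (grad d f x) * h x ∂(gibbs d U) =
      -∫ x, inner ℝ (b x) (grad d h x) * f x ∂(gibbs d U))
    (lam : ℝ) (hlam : 0 < lam) :
    IsShiftInverse (generator d U) lam (shiftInverse (generator d U) lam) ∧
    (∀ c : ℝ, IsShiftInverse (driftGenerator d U b c) lam
      (shiftInverse (driftGenerator d U b c) lam)) ∧
    (∀ u ∈ sobolevH1 d (gibbs d U), ∃! p, IsKerProj d (gibbs d U) b lam u p) ∧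
    ∀ g : Lp ℝ 2 (gibbs d U),
      (∀ c : ℝ, resolventOp (driftGenerator d U b c) lam g ∈ sobolevH1 d (gibbs d U)) ∧
      shiftInverse (generator d U) lam g ∈ sobolevH1 d (gibbs d U) ∧
      limitResolvent d U b lam g ∈ driftKer d (gibbs d U) b ∧
      Tendsto (fun c : ℝ => normH1 d (gibbs d U)
          (resolventOp (driftGenerator d U b c) lam g - limitResolvent d U b lam g))
        (Bornology.cobounded ℝ) (𝓝 0) ∧
      (∫ x, g x ∂(gibbs d U) = 0 →
        (∀ c : ℝ, ∫ x, resolventOp (driftGenerator d U b c) lam g x ∂(gibbs d U) = 0) ∧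
        ∫ x, limitResolvent d U b lam g x ∂(gibbs d U) = 0) := by
  obtain ⟨V, _, _, _, j, ι, hm⟩ := exists_isFormModel d (gibbs d U) hlam L hL
  obtain ⟨Bt, hB⟩ := hm.exists_driftExtension hlam hbc hC
  have hskewB := hm.driftExtension_skew hB hskew
  set J : Lp ℝ 2 (gibbs d U) →L[ℝ] V := ι.adjoint with hJ
  set T : V →L[ℝ] V := J ∘L Bt with hT
  have hTskew : ∀ v w, inner ℝ (T v) w = -inner ℝ v (T w) := by
    intro v w
    simp only [hT, hJ, ContinuousLinearMap.comp_apply, ContinuousLinearMap.adjoint_inner_left,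
      ContinuousLinearMap.adjoint_inner_right, hskewB]
  -- `J` is injective, since J h = 0 makes h orthogonal to the dense range of ι.
  have hker : ∀ v, T v = 0 ↔ Bt v = 0 := by
    refine fun v => ⟨fun h => hd.eq_zero_of_inner_left ℝ fun f => ?_, fun h => ?_⟩
    · rw [← hm.apply, ← ContinuousLinearMap.adjoint_inner_left]
      change inner ℝ (T v) _ = 0
      rw [h, inner_zero_left]
    · rw [hT, ContinuousLinearMap.comp_apply, h, map_zero]
  let R : ℝ → V →L[ℝ] V := fun c => Ring.inverse (1 - c • T)
  have hR : ∀ c v, R c v - (c • T) (R c v) = v := fun c v => by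
    have := Ring.mul_inverse_cancel _ (isUnit_one_sub_smul_skew hTskew c)
    exact DFunLike.congr_fun this v
  have hR' : ∀ c v, R c (v - (c • T) v) = v := fun c v => by
    have := Ring.inverse_mul_cancel _ (isUnit_one_sub_smul_skew hTskew c)
    exact DFunLike.congr_fun this v
  have hinvc : ∀ c, IsShiftInverse (driftGenerator d U b c) lam (-(ι ∘L R c ∘L J)) := fun c =>
    isShiftInverse_of_graph (hm.mem_graph_driftGenerator hLc hL hd hB c) (hR c) (hR' c)
  -- The operator A itself is the case without skew term, `Q = 0`.
  have hinv : IsShiftInverse (generator d U) lam (-(ι ∘L (1 : V →L[ℝ] V) ∘L J)) := by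
    refine isShiftInverse_of_graph (Q := 0) (fun x y => ?_) (by simp) (by simp)
    simpa using hm.mem_graph_generator hLc hL hd x y
  have hres : ∀ c g, resolventOp (driftGenerator d U b c) lam g = ι (R c (J g)) := fun c g => by
    rw [resolventOp, (hinvc c).shiftInverse_eq]
    simp
  have hres0 : ∀ g, shiftInverse (generator d U) lam g = ι (-(J g)) := fun g => by
    rw [hinv.shiftInverse_eq]
    simp
  have huniq : ∀ u ∈ sobolevH1 d (gibbs d U), ∃! p, IsKerProj d (gibbs d U) b lam u p := by
    intro u hu
    obtain ⟨v, rfl⟩ := hm.mem_sobolevH1.1 hu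
    exact hm.existsUnique_isKerProj hB v
  refine ⟨hinv.shiftInverse_eq ▸ hinv, fun c => (hinvc c).shiftInverse_eq ▸ hinvc c, huniq,
    fun g => ?_⟩
  have hmem : ∀ v, ι v ∈ sobolevH1 d (gibbs d U) := fun v => hm.mem_sobolevH1.2 ⟨v, rfl⟩
  obtain ⟨p, hp, hBp, hpk⟩ : ∃ p, limitResolvent d U b lam g = ι p ∧ Bt p = 0 ∧
      ∀ k, Bt k = 0 → inner ℝ (J g - p) k = 0 := by
    have h1 : ∃ q, IsKerProj d (gibbs d U) b lam (ι (-(J g))) q := (huniq _ (hmem _)).exists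
    obtain ⟨p, hp, hBp, hpk⟩ := (hm.isKerProj_iff hB _ _).1 h1.choose_spec
    -- `limitResolvent` is minus the projection of (A - lam)⁻¹g = -Jg; the two signs cancel, and the
    -- limit is the projection of Jg.
    refine ⟨-p, ?_, by rw [map_neg, hBp, neg_zero], fun k hk => ?_⟩
    · rw [limitResolvent, hres0, kerProj, dif_pos h1, ← hp, map_neg]
    · have h2 := hpk k hk
      rw [← neg_eq_zero, ← inner_neg_left] at h2
      rw [← h2]
      congr 1
      abel
  have hRx : ∀ c, R c (J g) - c • T (R c (J g)) = J g := fun c => hR c (J g)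
  have hlim : Tendsto (fun c => R c (J g)) (Bornology.cobounded ℝ) (𝓝 p) :=
    tendsto_resolvent_skew hTskew hRx ((hker p).2 hBp)
      (mem_closure_range_of_mem_ker_orthogonal hTskew fun k hk => hpk k ((hker k).1 hk))
  refine ⟨fun c => hres c g ▸ hmem _, hres0 g ▸ hmem _, ?_, ?_, fun hg => ?_⟩
  · rw [hp]
    exact (hm.mem_driftKer hB _).2 ⟨p, rfl, hBp⟩
  · simp only [hres, hp]
    exact hm.tendsto_normH1 hlim
  · have hgrad : ∀ x, grad d (⇑(1 : C^∞⟮𝓡 d, M; 𝓘(ℝ, ℝ), ℝ⟯)) x = 0 := by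
      intro x
      have h1 : mfderiv (𝓡 d) 𝓘(ℝ, ℝ) (⇑(1 : C^∞⟮𝓡 d, M; 𝓘(ℝ, ℝ), ℝ⟯)) x =
          (0 : TangentSpace (𝓡 d) x →L[ℝ] ℝ) := mfderiv_const
      unfold grad
      exact (congrArg (InnerProductSpace.toDual ℝ (TangentSpace (𝓡 d) x)).symm h1).trans
        (map_zero _)
    have hB1 : Bt (j 1) = 0 := by
      refine Lp.ext ?_
      filter_upwards [hB 1, Lp.coeFn_zero ℝ 2 (gibbs d U)] with x h1 h2
      rw [h1, h2, hgrad, inner_zero_right]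
      rfl
    have hint : ∀ u : Lp ℝ 2 (gibbs d U), inner ℝ u (toL2 d (gibbs d U) 1) =
        ∫ x, u x ∂(gibbs d U) := by
      intro u
      rw [inner_toL2 (gibbs d U) u u (ae_eq_refl _)]
      simp
    -- The gradient of 1 vanishes, so only the L² part of ⟨·,·⟩_{1,lam} remains. As lam is nonzero,
    -- mean zero is orthogonality to 1 in `V`.
    have hone : ∀ v, inner ℝ v (j 1) = lam * ∫ x, ι v x ∂(gibbs d U) := by
      intro v
      rw [← hint]
      refine hm.denseRange.induction_on v (isClosed_eq (by fun_prop) (by fun_prop)) fun f => ?_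
      rw [hm.inner_apply, hm.apply, energy]
      simp only [hgrad, inner_zero_right, integral_zero, zero_add]
    have hJg : inner ℝ (J g) (j 1) = 0 := by
      rw [hJ, ContinuousLinearMap.adjoint_inner_left, hm.apply, hint, hg]
    have hmean : ∀ v, inner ℝ v (j 1) = 0 → ∫ x, ι v x ∂(gibbs d U) = 0 := by
      intro v hv
      rw [hone] at hv
      exact (mul_eq_zero.1 hv).resolve_left hlam.ne'
    refine ⟨fun c => ?_, ?_⟩
    · rw [hres]
      refine hmean _ ?_
      -- Skewness moves T onto 1, where it vanishes, so the solution and Jg have the same product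
      -- with 1.
      have h1 := congrArg (fun v => inner ℝ v (j 1)) (hRx c)
      rw [inner_sub_left, real_inner_smul_left, hTskew, (hker _).2 hB1, inner_zero_right, neg_zero,
        mul_zero, sub_zero] at h1
      rw [h1, hJg]
    · rw [hp]
      refine hmean _ ?_
      have h1 := hpk _ hB1
      rw [inner_sub_left, hJg, zero_sub, neg_eq_zero] at h1
      exact h1

/-! ### Coordinate expressions and their smoothness -/

section Charts

theorem sum_mul_apply_single {d : ℕ} (L : EuclideanSpace ℝ (Fin d) →L[ℝ] ℝ)
    (v : EuclideanSpace ℝ (Fin d)) :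
    ∑ j, v j * L (EuclideanSpace.single j (1 : ℝ)) = L v := by
  conv_rhs => rw [← (EuclideanSpace.basisFun (Fin d) ℝ).sum_repr v]
  simp

theorem contDiffOn_det {n : Type*} [Fintype n] [DecidableEq n] {E : Type*} [NormedAddCommGroup E]
    [NormedSpace ℝ E] {m : ℕ∞ω} {s : Set E} {A : E → Matrix n n ℝ}
    (hA : ∀ i k, ContDiffOn ℝ m (fun y => A y i k) s) : ContDiffOn ℝ m (fun y => (A y).det) s := by
  simp only [Matrix.det_apply]
  exact ContDiffOn.sum fun σ _ => (contDiffOn_prod fun i _ => hA _ _).const_smul _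

variable {d : ℕ} {M : Type*} [TopologicalSpace M] [ChartedSpace (EuclideanSpace ℝ (Fin d)) M]
  [IsManifold (𝓡 d) ∞ M] {e : OpenPartialHomeomorph M (EuclideanSpace ℝ (Fin d))}
  {y : EuclideanSpace ℝ (Fin d)}

theorem mdifferentiable_chart_of_mem (he : e ∈ atlas (EuclideanSpace ℝ (Fin d)) M) :
    e.MDifferentiable (𝓡 d) (𝓡 d) :=
  mdifferentiable_of_mem_atlas he

theorem contMDiffOn_chart_of_mem (he : e ∈ atlas (EuclideanSpace ℝ (Fin d)) M) :
    ContMDiffOn (𝓡 d) (𝓡 d) ∞ e e.source :=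
  contMDiffOn_of_mem_maximalAtlas (IsManifold.subset_maximalAtlas he)

theorem contMDiffOn_chart_symm_of_mem (he : e ∈ atlas (EuclideanSpace ℝ (Fin d)) M) :
    ContMDiffOn (𝓡 d) (𝓡 d) ∞ e.symm e.target :=
  contMDiffOn_symm_of_mem_maximalAtlas (IsManifold.subset_maximalAtlas he)

theorem contDiffOn_comp_chart_symm {n : ℕ∞} {h : M → ℝ} (hh : ContMDiff (𝓡 d) 𝓘(ℝ, ℝ) n h)
    (he : e ∈ atlas (EuclideanSpace ℝ (Fin d)) M) : ContDiffOn ℝ n (h ∘ e.symm) e.target :=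
  contMDiffOn_iff_contDiffOn.1 (hh.comp_contMDiffOn
    ((contMDiffOn_chart_symm_of_mem he).of_le (by norm_cast; exact le_top)))

theorem mfderiv_mfderiv_symm (he : e ∈ atlas (EuclideanSpace ℝ (Fin d)) M) (hy : y ∈ e.target)
    (v : EuclideanSpace ℝ (Fin d)) :
    mfderiv (𝓡 d) (𝓡 d) e (e.symm y) (mfderiv (𝓡 d) (𝓡 d) e.symm y v) = v :=
  DFunLike.congr_fun ((mdifferentiable_chart_of_mem he).comp_symm_deriv hy) v

theorem mfderiv_symm_coordComp (he : e ∈ atlas (EuclideanSpace ℝ (Fin d)) M) (hy : y ∈ e.target)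
    (X : (x : M) → TangentSpace (𝓡 d) x) :
    mfderiv (𝓡 d) (𝓡 d) e.symm y (coordComp d e X y) = X (e.symm y) :=
  (mdifferentiable_chart_of_mem he).mfderiv_injective (e.map_target hy)
    (mfderiv_mfderiv_symm he hy _)

theorem fderiv_comp_chart_symm (he : e ∈ atlas (EuclideanSpace ℝ (Fin d)) M) (hy : y ∈ e.target)
    {h : M → ℝ} (hh : MDifferentiableAt (𝓡 d) 𝓘(ℝ, ℝ) h (e.symm y))
    (v : EuclideanSpace ℝ (Fin d)) :
    fderiv ℝ (h ∘ e.symm) y v =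
      mfderiv (𝓡 d) 𝓘(ℝ, ℝ) h (e.symm y) (mfderiv (𝓡 d) (𝓡 d) e.symm y v) := by
  rw [← mfderiv_eq_fderiv]
  exact DFunLike.congr_fun
    (mfderiv_comp y hh ((mdifferentiable_chart_of_mem he).mdifferentiableAt_symm hy)) v

theorem sum_coordComp_mul_fderiv (he : e ∈ atlas (EuclideanSpace ℝ (Fin d)) M)
    (hy : y ∈ e.target) {h : M → ℝ} (hh : MDifferentiableAt (𝓡 d) 𝓘(ℝ, ℝ) h (e.symm y))
    (X : (x : M) → TangentSpace (𝓡 d) x) :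
    ∑ j, coordComp d e X y j * fderiv ℝ (h ∘ e.symm) y (EuclideanSpace.single j 1) =
      (mfderiv (𝓡 d) 𝓘(ℝ, ℝ) h (e.symm y) (X (e.symm y)) : ℝ) := by
  rw [sum_mul_apply_single, fderiv_comp_chart_symm he hy hh, mfderiv_symm_coordComp he hy]

theorem contMDiffOn_coordVec (he : e ∈ atlas (EuclideanSpace ℝ (Fin d)) M) (j : Fin d) :
    ContMDiffOn (𝓡 d) (𝓡 d).tangent ∞
      (fun y => (⟨e.symm y, coordVec d e y j⟩ : TangentBundle (𝓡 d) M)) e.target := by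
  have h1 := (contMDiffOn_chart_symm_of_mem he).contMDiffOn_tangentMapWithin (m := ∞) (by simp)
    e.open_target.uniqueMDiffOn
  have h2 : ContMDiffOn (𝓡 d) (𝓡 d).tangent ∞
      (fun y : EuclideanSpace ℝ (Fin d) => (⟨y, (EuclideanSpace.single j (1 : ℝ) :
        EuclideanSpace ℝ (Fin d))⟩ : TangentBundle (𝓡 d) (EuclideanSpace ℝ (Fin d)))) e.target :=
    contMDiffOn_vectorSpace_iff_contDiffOn.2 contDiffOn_const
  refine (h1.comp h2 fun y hy => hy).congr fun y hy => ?_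
  simp only [Function.comp_apply, tangentMapWithin, coordVec]
  rw [mfderivWithin_of_isOpen e.open_target hy]

theorem contDiffOn_coordComp {n : ℕ∞} {X : (x : M) → TangentSpace (𝓡 d) x}
    (hX : ContMDiff (𝓡 d) (𝓡 d).tangent n (fun x => (⟨x, X x⟩ : TangentBundle (𝓡 d) M)))
    (he : e ∈ atlas (EuclideanSpace ℝ (Fin d)) M) : ContDiffOn ℝ n (coordComp d e X) e.target := by
  have h1 := (contMDiffOn_chart_of_mem he).contMDiffOn_tangentMapWithin (m := n)
    (by norm_cast; exact le_top) e.open_source.uniqueMDiffOn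
  have h2 : ContMDiffOn (𝓡 d) (𝓡 d).tangent n
      (fun y => (⟨e.symm y, X (e.symm y)⟩ : TangentBundle (𝓡 d) M)) e.target :=
    hX.comp_contMDiffOn ((contMDiffOn_chart_symm_of_mem he).of_le (by norm_cast; exact le_top))
  refine contMDiffOn_vectorSpace_iff_contDiffOn.1 ((h1.comp h2 fun y hy => e.map_target hy).congr
    fun y hy => ?_)
  simp only [Function.comp_apply, tangentMapWithin, coordComp]
  rw [mfderivWithin_of_isOpen e.open_source (e.map_target hy)]
  exact TotalSpace.ext (e.right_inv hy).symm HEq.rfl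

variable [RiemannianBundle (fun x : M => TangentSpace (𝓡 d) x)]

/-- The derivative of the inverse chart is injective, so the coordinate vectors are independent.
Positivity makes √g smooth and invertible on the chart. -/
theorem det_gram_coordVec_pos (he : e ∈ atlas (EuclideanSpace ℝ (Fin d)) M) (hy : y ∈ e.target) :
    0 < (Matrix.gram ℝ (coordVec d e y)).det := by
  refine (Matrix.posDef_gram_of_linearIndependent ?_).det_pos
  have h1 := (EuclideanSpace.basisFun (Fin d) ℝ).toBasis.linearIndependent
  have h2 := h1.map_injOn (mfderiv (𝓡 d) (𝓡 d) e.symm y).toLinearMap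
    (Function.Injective.injOn ((mdifferentiable_chart_of_mem he).symm.mfderiv_injective hy))
  simp only [OrthonormalBasis.coe_toBasis, Function.comp_def, EuclideanSpace.basisFun_apply] at h2
  exact h2

theorem sqrtDet_pos (he : e ∈ atlas (EuclideanSpace ℝ (Fin d)) M) (hy : y ∈ e.target) :
    0 < sqrtDet d e y :=
  Real.sqrt_pos.2 (det_gram_coordVec_pos he hy)

section

variable [IsContMDiffRiemannianBundle (𝓡 d) ∞ (EuclideanSpace ℝ (Fin d))
    (fun x : M => TangentSpace (𝓡 d) x)]

theorem contDiffOn_inner_coordVec (he : e ∈ atlas (EuclideanSpace ℝ (Fin d)) M) (j k : Fin d) :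
    ContDiffOn ℝ ∞ (fun y => (inner ℝ (coordVec d e y j) (coordVec d e y k) : ℝ)) e.target :=
  contMDiffOn_iff_contDiffOn.1
    ((contMDiffOn_coordVec he j).inner_bundle (contMDiffOn_coordVec he k))

theorem contDiffOn_sqrtDet (he : e ∈ atlas (EuclideanSpace ℝ (Fin d)) M) :
    ContDiffOn ℝ ∞ (sqrtDet d e) e.target :=
  (contDiffOn_det fun j k => contDiffOn_inner_coordVec he j k).sqrt
    fun _ hy => (det_gram_coordVec_pos he hy).ne'

/-- The components ξ of the gradient solve Gξ = ∂f, with G the Gram matrix of the coordinate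
vectors. Cramer's rule writes them as quotients of determinants with smooth entries, with the
denominator det G > 0. -/
theorem contDiffOn_coordComp_grad (he : e ∈ atlas (EuclideanSpace ℝ (Fin d)) M)
    (f : C^∞⟮𝓡 d, M; 𝓘(ℝ, ℝ), ℝ⟯) : ContDiffOn ℝ ∞ (coordComp d e (grad d f)) e.target := by
  let D : EuclideanSpace ℝ (Fin d) → Fin d → ℝ := fun y k =>
    fderiv ℝ (f ∘ e.symm) y (EuclideanSpace.single k 1)
  have hf : ContDiffOn ℝ ∞ (f ∘ e.symm) e.target :=
    contMDiffOn_iff_contDiffOn.1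
      (f.contMDiff.comp_contMDiffOn (contMDiffOn_chart_symm_of_mem he))
  have hD : ∀ k, ContDiffOn ℝ ∞ (fun y => D y k) e.target := fun k =>
    (hf.fderiv_of_isOpen e.open_target (by simp)).clm_apply contDiffOn_const
  have key : ∀ y ∈ e.target, (Matrix.gram ℝ (coordVec d e y)).mulVec (coordComp d e (grad d f) y) =
      D y := by
    intro y hy
    ext k
    simp only [D]
    rw [fderiv_comp_chart_symm he hy f.mdifferentiableAt, ← inner_grad_right,
      ← mfderiv_symm_coordComp he hy (grad d f), real_inner_comm]
    refine Eq.trans ?_ (sum_mul_apply_single ((innerSL ℝ (coordVec d e y k)).comp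
      (mfderiv (𝓡 d) (𝓡 d) e.symm y)) (coordComp d e (grad d f) y))
    simp only [Matrix.mulVec, dotProduct]
    exact Finset.sum_congr rfl fun i _ => mul_comm (_ : ℝ) _
  rw [contDiffOn_euclidean]
  intro j
  have h1 : ContDiffOn ℝ ∞ (fun y => (Matrix.gram ℝ (coordVec d e y)).det⁻¹ *
      ((Matrix.gram ℝ (coordVec d e y)).updateCol j (D y)).det) e.target := by
    refine ContDiffOn.mul (ContDiffOn.inv (contDiffOn_det fun j k => ?_)
      fun y hy => (det_gram_coordVec_pos he hy).ne') (contDiffOn_det fun i k => ?_)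
    · exact contDiffOn_inner_coordVec he j k
    · simp only [Matrix.updateCol_apply]
      split_ifs
      · exact hD i
      · exact contDiffOn_inner_coordVec he i k
  refine h1.congr fun y hy => ?_
  have h2 := (det_gram_coordVec_pos he hy).ne'
  rw [← Matrix.cramer_apply, ← key y hy, Matrix.cramer_eq_adjugate_mulVec, Matrix.mulVec_mulVec,
    Matrix.adjugate_mul, Matrix.smul_mulVec, Matrix.one_mulVec, Pi.smul_apply, smul_eq_mul,
    inv_mul_cancel_left₀ h2]

end

end Charts

/-! ### Change of charts and the Riemannian volume -/

section Volume

theorem det_gram_of_eq_sum {n F : Type*} [Fintype n] [DecidableEq n] [NormedAddCommGroup F]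
    [InnerProductSpace ℝ F] {A : Matrix n n ℝ} {v w : n → F} (h : ∀ j, v j = ∑ i, A i j • w i) :
    (Matrix.gram ℝ v).det = A.det ^ 2 * (Matrix.gram ℝ w).det := by
  have h1 : Matrix.gram ℝ v = A.transpose * Matrix.gram ℝ w * A := by
    ext j k
    simp only [Matrix.gram_apply, h, sum_inner, inner_sum, real_inner_smul_left,
      real_inner_smul_right, Matrix.mul_apply, Matrix.transpose_apply, Finset.sum_mul]
    exact Finset.sum_congr rfl fun i _ => Finset.sum_congr rfl fun l _ => by ring
  rw [h1, Matrix.det_mul, Matrix.det_mul, Matrix.det_transpose]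
  ring

variable {d : ℕ} {M : Type*} [TopologicalSpace M] [ChartedSpace (EuclideanSpace ℝ (Fin d)) M]
  [IsManifold (𝓡 d) ∞ M] {e e' : OpenPartialHomeomorph M (EuclideanSpace ℝ (Fin d))}
  {y : EuclideanSpace ℝ (Fin d)}

theorem differentiableAt_transition (he : e ∈ atlas (EuclideanSpace ℝ (Fin d)) M)
    (he' : e' ∈ atlas (EuclideanSpace ℝ (Fin d)) M) (hy : y ∈ e.target)
    (hy' : e.symm y ∈ e'.source) : DifferentiableAt ℝ (e' ∘ e.symm) y :=
  (((mdifferentiable_chart_of_mem he').mdifferentiableAt hy').comp y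
    ((mdifferentiable_chart_of_mem he).mdifferentiableAt_symm hy)).differentiableAt

theorem mfderiv_symm_transition (he : e ∈ atlas (EuclideanSpace ℝ (Fin d)) M)
    (he' : e' ∈ atlas (EuclideanSpace ℝ (Fin d)) M) (hy : y ∈ e.target)
    (hy' : e.symm y ∈ e'.source) (v : EuclideanSpace ℝ (Fin d)) :
    (mfderiv (𝓡 d) (𝓡 d) e.symm y v : EuclideanSpace ℝ (Fin d)) =
      mfderiv (𝓡 d) (𝓡 d) e'.symm ((e' ∘ e.symm) y) (fderiv ℝ (e' ∘ e.symm) y v) := by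
  have h1 : HasMFDerivAt (𝓡 d) (𝓡 d) e'.symm ((e' ∘ e.symm) y)
      (mfderiv (𝓡 d) (𝓡 d) e'.symm ((e' ∘ e.symm) y)) :=
    ((mdifferentiable_chart_of_mem he').mdifferentiableAt_symm (e'.map_source hy')).hasMFDerivAt
  have h2 := (differentiableAt_transition he he' hy hy').hasFDerivAt.hasMFDerivAt
  have h3 := (h1.comp y h2).congr_of_eventuallyEq (f₁ := e.symm) (by
    have hev : ∀ᶠ z in 𝓝 y, e.symm z ∈ e'.source :=
      (e.continuousAt_symm hy).preimage_mem_nhds (e'.open_source.mem_nhds hy')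
    filter_upwards [hev] with z hz
    exact (e'.left_inv hz).symm)
  have h4 := ((mdifferentiable_chart_of_mem he).mdifferentiableAt_symm hy).hasMFDerivAt
  exact DFunLike.congr_fun (hasMFDerivAt_unique h4 h3) v

variable [RiemannianBundle (fun x : M => TangentSpace (𝓡 d) x)]

/-- The coordinate vectors of two charts lie in tangent spaces at points that are only provably
equal. This carries the Gram determinants of both to the tangent space at one point `x`. -/
theorem sqrtDet_eq_of_eq {x : M} (h : e.symm y = x) (v : Fin d → EuclideanSpace ℝ (Fin d))
    (hv : ∀ j, (coordVec d e y j : EuclideanSpace ℝ (Fin d)) = v j) :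
    sqrtDet d e y = √(Matrix.gram ℝ (E := TangentSpace (𝓡 d) x) v).det := by
  subst h
  have : v = coordVec d e y := (funext hv).symm
  rw [this]
  rfl

/-- The coordinate vectors of `e` arise from those of `e'` through the Jacobian matrix of the
transition map, so the Gram determinant picks up the square of the Jacobian determinant. -/
theorem sqrtDet_transition (he : e ∈ atlas (EuclideanSpace ℝ (Fin d)) M)
    (he' : e' ∈ atlas (EuclideanSpace ℝ (Fin d)) M) (hy : y ∈ e.target)
    (hy' : e.symm y ∈ e'.source) :
    sqrtDet d e y = |(fderiv ℝ (e' ∘ e.symm) y).det| * sqrtDet d e' (e' (e.symm y)) := by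
  let D : EuclideanSpace ℝ (Fin d) →L[ℝ] EuclideanSpace ℝ (Fin d) :=
    mfderiv (𝓡 d) (𝓡 d) e'.symm ((e' ∘ e.symm) y)
  let A := fderiv ℝ (e' ∘ e.symm) y
  let B := (EuclideanSpace.basisFun (Fin d) ℝ).toBasis
  have h1 := sqrtDet_eq_of_eq (e := e) (y := y) rfl
    (fun j => D (A (EuclideanSpace.single j (1 : ℝ)))) fun j =>
      mfderiv_symm_transition he he' hy hy' _
  have h2 := sqrtDet_eq_of_eq (e := e') (y := e' (e.symm y)) (e'.left_inv hy')
    (fun j => D (EuclideanSpace.single j (1 : ℝ))) fun j => rfl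
  rw [h1, h2, ← Real.sqrt_sq_eq_abs, ← Real.sqrt_mul (sq_nonneg _)]
  congr 1
  have h3 : A.det = (LinearMap.toMatrix B B A.toLinearMap).det := (LinearMap.det_toMatrix B _).symm
  change _ = A.det ^ 2 * _
  rw [h3]
  refine det_gram_of_eq_sum fun j => ?_
  have h4 : A (EuclideanSpace.single j (1 : ℝ)) =
      ∑ i, LinearMap.toMatrix B B A.toLinearMap i j • EuclideanSpace.single i (1 : ℝ) := by
    conv_lhs => rw [← (EuclideanSpace.basisFun (Fin d) ℝ).sum_repr
      (A (EuclideanSpace.single j (1 : ℝ)))]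
    simp [LinearMap.toMatrix_apply, B]
  have h5 := congrArg D h4
  rw [map_sum] at h5
  simp only [map_smul] at h5
  exact h5

variable [MeasurableSpace M] [BorelSpace M]

/-- The Riemannian volume on the domain of the chart `e`. -/
noncomputable def chartVol (d : ℕ) {M : Type*} [TopologicalSpace M]
    [ChartedSpace (EuclideanSpace ℝ (Fin d)) M]
    [RiemannianBundle (fun x : M => TangentSpace (𝓡 d) x)] [MeasurableSpace M]
    (e : OpenPartialHomeomorph M (EuclideanSpace ℝ (Fin d))) : Measure M :=
  ((volume.restrict e.target).withDensity fun y => ENNReal.ofReal (sqrtDet d e y)).map e.symm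

theorem aemeasurable_chart_symm (e : OpenPartialHomeomorph M (EuclideanSpace ℝ (Fin d))) :
    AEMeasurable e.symm
      ((volume.restrict e.target).withDensity fun y => ENNReal.ofReal (sqrtDet d e y)) :=
  (e.continuousOn_symm.aemeasurable e.open_target.measurableSet).mono_ac
    (withDensity_absolutelyContinuous _ _)

theorem measurableSet_inter_preimage_symm (e : OpenPartialHomeomorph M (EuclideanSpace ℝ (Fin d)))
    {S : Set M} (hS : MeasurableSet S) : MeasurableSet (e.symm ⁻¹' S ∩ e.target) := by
  have h1 : Measurable (e.target.domRestrict e.symm) :=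
    (continuousOn_iff_continuous_domRestrict.1 e.continuousOn_symm).measurable
  have h2 := (MeasurableEmbedding.subtype_coe e.open_target.measurableSet).measurableSet_image.2
    (h1 hS)
  convert! h2 using 1
  ext y
  simp [Set.domRestrict, and_comm]

theorem chartVol_apply (e : OpenPartialHomeomorph M (EuclideanSpace ℝ (Fin d))) {S : Set M}
    (hS : MeasurableSet S) : chartVol d e S =
      ∫⁻ y in e.symm ⁻¹' S ∩ e.target, ENNReal.ofReal (sqrtDet d e y) := by
  rw [chartVol, Measure.map_apply_of_aemeasurable (aemeasurable_chart_symm e) hS,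
    withDensity_apply', Measure.restrict_restrict' e.open_target.measurableSet]

/-- The factor |det| from the change of variables is the one in `sqrtDet_transition`. -/
theorem chartVol_transition (he : e ∈ atlas (EuclideanSpace ℝ (Fin d)) M)
    (he' : e' ∈ atlas (EuclideanSpace ℝ (Fin d)) M) {S : Set M} (hS : MeasurableSet S)
    (hSe : S ⊆ e.source) (hSe' : S ⊆ e'.source) : chartVol d e S = chartVol d e' S := by
  rw [chartVol_apply e hS, chartVol_apply e' hS]
  have himage : e'.symm ⁻¹' S ∩ e'.target = (e' ∘ e.symm) '' (e.symm ⁻¹' S ∩ e.target) := by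
    ext z
    constructor
    · rintro ⟨h1, h2⟩
      refine ⟨e (e'.symm z), ⟨?_, e.map_source (hSe h1)⟩, ?_⟩
      · rw [Set.mem_preimage, e.left_inv (hSe h1)]
        exact h1
      · rw [Function.comp_apply, e.left_inv (hSe h1), e'.right_inv h2]
    · rintro ⟨y, ⟨h1, h2⟩, rfl⟩
      refine ⟨?_, e'.map_source (hSe' h1)⟩
      rw [Set.mem_preimage, Function.comp_apply, e'.left_inv (hSe' h1)]
      exact h1
  have hmeas := measurableSet_inter_preimage_symm e hS
  rw [himage, lintegral_image_eq_lintegral_abs_det_fderiv_mul volume hmeas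
    (f' := fun y => fderiv ℝ (e' ∘ e.symm) y) (fun y hy =>
      (differentiableAt_transition he he' hy.2 (hSe' hy.1)).hasFDerivAt.hasFDerivWithinAt)]
  · refine setLIntegral_congr_fun hmeas fun y hy => ?_
    rw [sqrtDet_transition he he' hy.2 (hSe' hy.1), ENNReal.ofReal_mul (abs_nonneg _)]
    rfl
  · rintro y ⟨h1, h2⟩ z ⟨h3, h4⟩ h
    exact e.symm.injOn h2 h4 (e'.injOn (hSe' h1) (hSe' h3) h)

theorem chartVol_compl_source (e : OpenPartialHomeomorph M (EuclideanSpace ℝ (Fin d))) :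
    chartVol d e e.sourceᶜ = 0 := by
  rw [chartVol_apply e e.open_source.measurableSet.compl]
  have : e.symm ⁻¹' e.sourceᶜ ∩ e.target = ∅ := by
    ext y
    simp only [Set.mem_inter_iff, Set.mem_preimage, Set.mem_compl_iff, Set.mem_empty_iff_false,
      iff_false, not_and]
    exact fun h h' => h (e.map_target h')
  rw [this]
  simp

/-- Only the upper bound needs work. Compactness gives a finite cover by charts; cutting it into
disjoint pieces and taking on each piece the volume of its chart gives one measure `μ`. By
compatibility of the chart volumes, `μ` dominates all of them, hence their supremum, and it equals
`chartVol d e` inside the domain of `e`. -/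
theorem riemVol_apply [CompactSpace M] (he : e ∈ atlas (EuclideanSpace ℝ (Fin d)) M) {S : Set M}
    (hS : MeasurableSet S) (hSe : S ⊆ e.source) : riemVol d S = chartVol d e S := by
  refine le_antisymm ?_ ?_
  swap
  · exact Measure.le_iff'.1 (le_iSup₂ (f := fun (e : OpenPartialHomeomorph M
      (EuclideanSpace ℝ (Fin d))) (_ : e ∈ atlas (EuclideanSpace ℝ (Fin d)) M) => chartVol d e)
      e he) S
  obtain ⟨t, ht⟩ := isCompact_univ.elim_finite_subcover
    (fun x : M => (chartAt (EuclideanSpace ℝ (Fin d)) x).source)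
    (fun x => (chartAt (EuclideanSpace ℝ (Fin d)) x).open_source)
    (fun x _ => Set.mem_iUnion.2 ⟨x, mem_chart_source _ x⟩)
  let l : List M := t.toList
  -- The finite cover is continued by empty sets to a sequence, so that `disjointed` applies.
  let s : ℕ → Set M := fun n => if h : n < l.length then
    (chartAt (EuclideanSpace ℝ (Fin d)) l[n]).source else ∅
  have hs : ∀ n, MeasurableSet (s n) := by
    intro n
    simp only [s]
    split_ifs
    · exact (OpenPartialHomeomorph.open_source _).measurableSet
    · exact MeasurableSet.empty
  have hsu : ⋃ n, disjointed s n = Set.univ := by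
    rw [iUnion_disjointed, Set.eq_univ_iff_forall]
    intro x
    obtain ⟨z, hz, hxz⟩ := Set.mem_iUnion₂.1 (ht (Set.mem_univ x))
    obtain ⟨n, hn, hnz⟩ := List.getElem_of_mem (Finset.mem_toList.2 hz)
    refine Set.mem_iUnion.2 ⟨n, ?_⟩
    simp only [s]
    rw [dif_pos hn, hnz]
    exact hxz
  have hdm : ∀ n, MeasurableSet (disjointed s n) := fun n => MeasurableSet.disjointed hs n
  have hdec : ∀ (μ : Measure M) (R : Set M), MeasurableSet R →
      μ R = ∑' n, μ (R ∩ disjointed s n) := by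
    intro μ R hR
    rw [← measure_iUnion (fun i k hik => ((disjoint_disjointed s hik).mono
      Set.inter_subset_right Set.inter_subset_right)) fun n => hR.inter (hdm n),
      ← Set.inter_iUnion, hsu, Set.inter_univ]
  let ν : ℕ → Measure M := fun n => if h : n < l.length then
    chartVol d (chartAt (EuclideanSpace ℝ (Fin d)) l[n]) else 0
  have hν : ∀ e₀ ∈ atlas (EuclideanSpace ℝ (Fin d)) M, ∀ n R, MeasurableSet R → R ⊆ e₀.source →
      R ⊆ s n → chartVol d e₀ R = ν n R := by
    intro e₀ he₀ n R hR h1 h2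
    simp only [s, ν] at h2 ⊢
    split_ifs at h2 ⊢ with h
    · exact chartVol_transition he₀ (chart_mem_atlas _ _) hR h1 h2
    · rw [Set.subset_empty_iff.1 h2]
      simp
  let μ : Measure M := Measure.sum fun n => (ν n).restrict (disjointed s n)
  have hμ : ∀ e₀ ∈ atlas (EuclideanSpace ℝ (Fin d)) M, ∀ R, MeasurableSet R → R ⊆ e₀.source →
      chartVol d e₀ R = μ R := by
    intro e₀ he₀ R hR h1
    rw [hdec _ R hR, Measure.sum_apply _ hR]
    refine tsum_congr fun n => ?_
    rw [Measure.restrict_apply hR]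
    exact hν e₀ he₀ n _ (hR.inter (hdm n)) (Set.inter_subset_left.trans h1)
      (Set.inter_subset_right.trans (disjointed_subset s n))
  have hle : riemVol d ≤ μ := by
    refine iSup₂_le fun e₀ he₀ => Measure.le_intro fun R hR _ => ?_
    change chartVol d e₀ R ≤ μ R
    have h0 := e₀.open_source.measurableSet
    -- A chart volume does not charge the complement of its domain, so comparison inside the domain
    -- suffices.
    calc chartVol d e₀ R ≤ chartVol d e₀ (R ∩ e₀.source) + chartVol d e₀ e₀.sourceᶜ := by
          refine (measure_mono ?_).trans (measure_union_le _ _)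
          intro x hx
          by_cases h : x ∈ e₀.source
          · exact Or.inl ⟨hx, h⟩
          · exact Or.inr h
      _ = μ (R ∩ e₀.source) := by
          rw [chartVol_compl_source, add_zero, hμ e₀ he₀ _ (hR.inter h0) Set.inter_subset_right]
      _ ≤ μ R := measure_mono Set.inter_subset_left
  exact (Measure.le_iff'.1 hle S).trans_eq (hμ e he S hS hSe).symm

theorem riemVol_restrict_source [CompactSpace M] (he : e ∈ atlas (EuclideanSpace ℝ (Fin d)) M) :
    (riemVol d).restrict e.source = chartVol d e := by
  have h0 := e.open_source.measurableSet
  ext S hS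
  rw [Measure.restrict_apply hS, riemVol_apply he (hS.inter h0) Set.inter_subset_right]
  refine measure_congr ?_
  have : ∀ᵐ x ∂(chartVol d e), x ∈ e.source := by
    rw [ae_iff]
    exact chartVol_compl_source e
  filter_upwards [this] with x hx
  exact propext ⟨fun h => h.1, fun h => ⟨h, hx⟩⟩

end Volume

/-! ### The divergence theorem -/

section Divergence

/-- The integral of a derivative of a compactly supported product vanishes. -/
theorem setIntegral_mul_fderiv_add_fderiv_mul_eq_zero {E : Type*} [NormedAddCommGroup E]
    [NormedSpace ℝ E] [FiniteDimensional ℝ E] [MeasurableSpace E] [BorelSpace E] {μ : Measure E}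
    [μ.IsAddHaarMeasure] {W K : Set E} (hW : IsOpen W) (hK : IsCompact K) (hKW : K ⊆ W)
    {ψ g : E → ℝ} (hψ : ContDiffOn ℝ 1 ψ W) (hg : ContDiffOn ℝ 1 g W)
    (h0 : ∀ y ∈ W, y ∉ K → ψ y = 0) (v : E) :
    IntegrableOn (fun y => ψ y * fderiv ℝ g y v + g y * fderiv ℝ ψ y v) W μ ∧
      ∫ y in W, (ψ y * fderiv ℝ g y v + g y * fderiv ℝ ψ y v) ∂μ = 0 := by
  -- The product extended by zero is C¹ on the whole space: it vanishes near every point outside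
  -- `K`, and `K` lies inside the open set `W`.
  let F : E → ℝ := W.indicator fun y => ψ y * g y
  have hF0 : ∀ y, y ∉ K → F =ᶠ[𝓝 y] 0 := by
    intro y hy
    filter_upwards [hK.isClosed.isOpen_compl.mem_nhds hy] with z hz
    by_cases hzW : z ∈ W
    · simp [F, hzW, h0 z hzW hz]
    · simp [F, hzW]
  have hFW : ∀ y ∈ W, F =ᶠ[𝓝 y] fun y => ψ y * g y := by
    intro y hy
    filter_upwards [hW.mem_nhds hy] with z hz
    simp [F, hz]
  have hF : ContDiff ℝ 1 F := by
    rw [contDiff_iff_contDiffAt]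
    intro y
    by_cases hy : y ∈ K
    · exact (((hψ.mul hg).contDiffAt (hW.mem_nhds (hKW hy)))).congr_of_eventuallyEq
        (hFW y (hKW hy))
    · exact contDiffAt_const.congr_of_eventuallyEq (hF0 y hy)
  have hsupp : HasCompactSupport F := by
    refine HasCompactSupport.intro hK fun y hy => ?_
    exact (hF0 y hy).eq_of_nhds
  have hd : Continuous fun y => fderiv ℝ F y v :=
    (hF.continuous_fderiv one_ne_zero).clm_apply continuous_const
  have hds : HasCompactSupport fun y => fderiv ℝ F y v := hsupp.fderiv_apply ℝ v
  have hint : Integrable (fun y => fderiv ℝ F y v) μ := hd.integrable_of_hasCompactSupport hds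
  have heq : Set.EqOn (fun y => fderiv ℝ F y v)
      (fun y => ψ y * fderiv ℝ g y v + g y * fderiv ℝ ψ y v) W := by
    intro y hy
    have h1 := ((hψ.differentiableOn one_ne_zero).differentiableAt (hW.mem_nhds hy)).hasFDerivAt
    have h2 := ((hg.differentiableOn one_ne_zero).differentiableAt (hW.mem_nhds hy)).hasFDerivAt
    simp only
    rw [(hFW y hy).fderiv_eq, fderiv_fun_mul h1.differentiableAt h2.differentiableAt]
    simp
  have hzero : ∫ y, fderiv ℝ F y v ∂μ = 0 := by
    -- Integration by parts against the constant 1.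
    have h1 := integral_mul_fderiv_eq_neg_fderiv_mul_of_integrable (μ := μ) (f := fun _ : E => (1 : ℝ))
      (g := F) (v := v) (by simp) (by simpa using hint)
      (by simpa using hF.continuous.integrable_of_hasCompactSupport hsupp)
      (fun _ _ => differentiableAt_const _)
      (fun y _ => (hF.differentiable one_ne_zero).differentiableAt)
    simpa using h1
  refine ⟨hint.integrableOn.congr_fun heq hW.measurableSet, ?_⟩
  rw [← setIntegral_congr_fun hW.measurableSet heq,
    setIntegral_eq_integral_of_forall_compl_eq_zero, hzero]
  intro y hy
  rw [(hF0 y fun h => hy (hKW h)).fderiv_eq]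
  simp

variable {d : ℕ} {M : Type*} [TopologicalSpace M] [ChartedSpace (EuclideanSpace ℝ (Fin d)) M]
  [RiemannianBundle (fun x : M => TangentSpace (𝓡 d) x)]
  {e e' : OpenPartialHomeomorph M (EuclideanSpace ℝ (Fin d))}
  {X : (x : M) → TangentSpace (𝓡 d) x}

/-- The divergence of `X` at `x`, computed in the chart `e`. -/
noncomputable def chartDiv (d : ℕ) {M : Type*} [TopologicalSpace M]
    [ChartedSpace (EuclideanSpace ℝ (Fin d)) M]
    [RiemannianBundle (fun x : M => TangentSpace (𝓡 d) x)]
    (e : OpenPartialHomeomorph M (EuclideanSpace ℝ (Fin d)))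
    (X : (x : M) → TangentSpace (𝓡 d) x) (x : M) : ℝ :=
  (sqrtDet d e (e x))⁻¹ * ∑ j : Fin d,
    fderiv ℝ (fun y => sqrtDet d e y * coordComp d e X y j) (e x) (EuclideanSpace.single j 1)

theorem divergence_eq_chartDiv (X : (x : M) → TangentSpace (𝓡 d) x) (x : M) :
    divergence d X x = chartDiv d (chartAt (EuclideanSpace ℝ (Fin d)) x) X x := rfl

/-- The vector field `X` has `C¹` components in all charts. -/
def IsC1Field (X : (x : M) → TangentSpace (𝓡 d) x) : Prop :=
  ∀ e ∈ atlas (EuclideanSpace ℝ (Fin d)) M, ContDiffOn ℝ 1 (coordComp d e X) e.target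

variable [IsManifold (𝓡 d) ∞ M]

theorem sum_coordComp_mul_fderiv_eq_inner (he : e ∈ atlas (EuclideanSpace ℝ (Fin d)) M)
    {y : EuclideanSpace ℝ (Fin d)} (hy : y ∈ e.target) {h : M → ℝ}
    (hh : MDifferentiableAt (𝓡 d) 𝓘(ℝ, ℝ) h (e.symm y)) (X : (x : M) → TangentSpace (𝓡 d) x) :
    ∑ j, coordComp d e X y j * fderiv ℝ (h ∘ e.symm) y (EuclideanSpace.single j 1) =
      inner ℝ (grad d h (e.symm y)) (X (e.symm y)) := by
  rw [sum_coordComp_mul_fderiv he hy hh, inner_grad_right]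

variable [IsContMDiffRiemannianBundle (𝓡 d) ∞ (EuclideanSpace ℝ (Fin d))
    (fun x : M => TangentSpace (𝓡 d) x)]

theorem IsC1Field.contDiffOn_mul (hX : IsC1Field X)
    (he : e ∈ atlas (EuclideanSpace ℝ (Fin d)) M) (j : Fin d) :
    ContDiffOn ℝ 1 (fun y => sqrtDet d e y * coordComp d e X y j) e.target :=
  ((contDiffOn_sqrtDet he).of_le (by norm_cast)).mul
    (contDiffOn_euclidean.1 (hX e he) j)

theorem IsC1Field.continuousOn_chartDiv (hX : IsC1Field X)
    (he : e ∈ atlas (EuclideanSpace ℝ (Fin d)) M) : ContinuousOn (chartDiv d e X) e.source := by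
  have h1 : ContinuousOn (fun y => (sqrtDet d e y)⁻¹ * ∑ j : Fin d,
      fderiv ℝ (fun y => sqrtDet d e y * coordComp d e X y j) y (EuclideanSpace.single j 1))
      e.target :=
    ((contDiffOn_sqrtDet he).continuousOn.inv₀ fun y hy => (sqrtDet_pos he hy).ne').mul
      (continuousOn_finsetSum _ fun j _ =>
        ((hX.contDiffOn_mul he j).continuousOn_fderiv_of_isOpen e.open_target le_rfl).clm_apply
          continuousOn_const)
  exact h1.comp e.continuousOn e.mapsTo

theorem IsC1Field.continuous_inner_grad (hX : IsC1Field X) {h : M → ℝ}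
    (hh : ContMDiff (𝓡 d) 𝓘(ℝ, ℝ) 1 h) :
    Continuous fun x => (inner ℝ (grad d h x) (X x) : ℝ) := by
  rw [continuous_iff_continuousAt]
  intro x
  let e := chartAt (EuclideanSpace ℝ (Fin d)) x
  have he : e ∈ atlas (EuclideanSpace ℝ (Fin d)) M := chart_mem_atlas _ x
  have h1 : ContinuousOn (fun y => ∑ j, coordComp d e X y j *
      fderiv ℝ (h ∘ e.symm) y (EuclideanSpace.single j 1)) e.target := by
    refine continuousOn_finsetSum _ fun j _ => ?_
    have h3 := (contDiffOn_comp_chart_symm (n := 1) hh he).continuousOn_fderiv_of_isOpen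
      e.open_target le_rfl
    exact ((contDiffOn_euclidean.1 (hX e he) j).continuousOn).mul
      (h3.clm_apply continuousOn_const)
  have h2 := h1.comp e.continuousOn e.mapsTo
  refine (h2.continuousAt (e.open_source.mem_nhds (mem_chart_source _ x))).congr ?_
  filter_upwards [e.open_source.mem_nhds (mem_chart_source _ x)] with z hz
  rw [Function.comp_apply, sum_coordComp_mul_fderiv_eq_inner he (e.map_source hz)
    (hh.mdifferentiableAt one_ne_zero), e.left_inv hz]

theorem grad_eq_zero_of_eventuallyEq {h : M → ℝ} {x : M} (hh : h =ᶠ[𝓝 x] fun _ => (0 : ℝ)) :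
    grad d h x = 0 := by
  have h2 : HasMFDerivAt (𝓡 d) 𝓘(ℝ, ℝ) h x (0 : TangentSpace (𝓡 d) x →L[ℝ] ℝ) :=
    (hasMFDerivAt_const (0 : ℝ) x).congr_of_eventuallyEq hh
  exact (congrArg (InnerProductSpace.toDual ℝ (TangentSpace (𝓡 d) x)).symm h2.mfderiv).trans
    (map_zero _)

variable [MeasurableSpace M] [BorelSpace M]

theorem integral_riemVol_eq [CompactSpace M] (he : e ∈ atlas (EuclideanSpace ℝ (Fin d)) M)
    {F : M → ℝ} (hF : Continuous F) (h0 : ∀ x ∉ e.source, F x = 0) :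
    ∫ x, F x ∂(riemVol d) = ∫ y in e.target, sqrtDet d e y * F (e.symm y) := by
  have hm : SecondCountableTopology M :=
    ChartedSpace.secondCountable_of_sigmaCompact (EuclideanSpace ℝ (Fin d)) M
  rw [← setIntegral_eq_integral_of_forall_compl_eq_zero h0, riemVol_restrict_source he, chartVol,
    integral_map (aemeasurable_chart_symm e) hF.aestronglyMeasurable,
    integral_withDensity_eq_integral_toReal_smul₀]
  · refine integral_congr_ae (Eventually.of_forall fun y => ?_)
    simp only [smul_eq_mul]
    rw [ENNReal.toReal_ofReal (show 0 ≤ sqrtDet d e y from Real.sqrt_nonneg _)]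
  · exact ((contDiffOn_sqrtDet he).continuousOn.aemeasurable
      e.open_target.measurableSet).ennreal_ofReal
  · exact Eventually.of_forall fun y => ENNReal.ofReal_lt_top

theorem IsC1Field.continuous_local (hX : IsC1Field X)
    (he : e ∈ atlas (EuclideanSpace ℝ (Fin d)) M) {h : M → ℝ}
    (hh : Continuous h) (hs : tsupport h ⊆ e.source) :
    Continuous fun x => h x * chartDiv d e X x := by
  refine ContinuousOn.continuous_of_tsupport_subset
    (hh.continuousOn.mul (hX.continuousOn_chartDiv he)) e.open_source ?_
  exact (closure_mono (Function.support_mul_subset_left _ _)).trans hs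

/-- In coordinates √g times the integrand is ∑ ∂_j(h √g X^j), a sum of derivatives of functions with
compact support in the chart. -/
theorem IsC1Field.integral_local [CompactSpace M] (hX : IsC1Field X)
    (he : e ∈ atlas (EuclideanSpace ℝ (Fin d)) M) {h : M → ℝ}
    (hh : ContMDiff (𝓡 d) 𝓘(ℝ, ℝ) 1 h) (hs : tsupport h ⊆ e.source) :
    ∫ x, (h x * chartDiv d e X x + inner ℝ (grad d h x) (X x)) ∂(riemVol d) = 0 := by
  rw [integral_riemVol_eq (F := fun x => h x * chartDiv d e X x + inner ℝ (grad d h x) (X x)) he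
    ((hX.continuous_local he hh.continuous hs).add (hX.continuous_inner_grad hh))]
  swap
  · intro x hx
    have h1 : h =ᶠ[𝓝 x] fun _ => (0 : ℝ) := by
      filter_upwards [(isClosed_tsupport h).isOpen_compl.mem_nhds fun h' => hx (hs h')] with z hz
      exact image_eq_zero_of_notMem_tsupport hz
    rw [grad_eq_zero_of_eventuallyEq h1, inner_zero_left, h1.eq_of_nhds, zero_mul, add_zero]
  have hK : IsCompact (e '' tsupport h) :=
    (isClosed_tsupport h).isCompact.image_of_continuousOn (e.continuousOn.mono hs)
  have hKW : e '' tsupport h ⊆ e.target := by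
    rintro _ ⟨x, hx, rfl⟩
    exact e.map_source (hs hx)
  have key := fun j : Fin d => setIntegral_mul_fderiv_add_fderiv_mul_eq_zero (μ := volume)
    e.open_target hK hKW (contDiffOn_comp_chart_symm (n := 1) hh he) (hX.contDiffOn_mul he j)
    (fun y hy hyK => image_eq_zero_of_notMem_tsupport (f := h) fun h' =>
      hyK ⟨_, h', e.right_inv hy⟩) (EuclideanSpace.single j 1)
  have hsum : ∫ y in e.target, ∑ j : Fin d, ((h ∘ e.symm) y *
      fderiv ℝ (fun y => sqrtDet d e y * coordComp d e X y j) y (EuclideanSpace.single j 1) +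
      sqrtDet d e y * coordComp d e X y j *
        fderiv ℝ (h ∘ e.symm) y (EuclideanSpace.single j 1)) = 0 := by
    rw [integral_finsetSum _ fun j _ => (key j).1]
    exact Finset.sum_eq_zero fun j _ => (key j).2
  rw [← hsum]
  refine setIntegral_congr_fun e.open_target.measurableSet fun y hy => ?_
  simp only
  rw [← sum_coordComp_mul_fderiv_eq_inner he hy (hh.mdifferentiableAt one_ne_zero), chartDiv,
    e.right_inv hy, Finset.sum_add_distrib, ← Finset.mul_sum]
  simp only [mul_assoc]
  rw [← Finset.mul_sum, mul_add]
  have h3 := (sqrtDet_pos he hy).ne'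
  simp only [Function.comp_apply]
  congr 1
  field_simp

theorem riemVol_isOpenPosMeasure [CompactSpace M] : (riemVol d : Measure M).IsOpenPosMeasure := by
  refine ⟨fun O hO ⟨x, hx⟩ h0 => ?_⟩
  let e := chartAt (EuclideanSpace ℝ (Fin d)) x
  have he : e ∈ atlas (EuclideanSpace ℝ (Fin d)) M := chart_mem_atlas _ x
  have hOe := hO.inter e.open_source
  have h1 : riemVol d (O ∩ e.source) = 0 := measure_mono_null Set.inter_subset_left h0
  rw [riemVol_apply he hOe.measurableSet Set.inter_subset_right, chartVol_apply e
    hOe.measurableSet] at h1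
  have hmeas := measurableSet_inter_preimage_symm e hOe.measurableSet
  have hopen : IsOpen (e.symm ⁻¹' (O ∩ e.source) ∩ e.target) := by
    rw [Set.inter_comm]
    exact e.symm.isOpen_inter_preimage hOe
  have hne : (e.symm ⁻¹' (O ∩ e.source) ∩ e.target).Nonempty := by
    refine ⟨e x, ?_, e.map_source (mem_chart_source _ x)⟩
    rw [Set.mem_preimage, e.left_inv (mem_chart_source _ x)]
    exact ⟨hx, mem_chart_source _ x⟩
  rw [lintegral_eq_zero_iff' (((contDiffOn_sqrtDet he).continuousOn.mono
    Set.inter_subset_right).aemeasurable hmeas).ennreal_ofReal,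
    EventuallyEq, ae_restrict_iff' hmeas] at h1
  refine hopen.measure_ne_zero volume hne (measure_mono_null ?_ (ae_iff.1 h1))
  intro y hy h
  have := h hy
  simp only [Pi.zero_apply, ENNReal.ofReal_eq_zero] at this
  exact this.not_gt (sqrtDet_pos he hy.2)

/-- No transformation of derivatives is computed. On the overlap both expressions satisfy the same
identity `integral_local` against test functions, so they agree almost everywhere. Both are
continuous and the volume charges every nonempty open set, so they agree everywhere. -/
theorem IsC1Field.chartDiv_eq [CompactSpace M] [T2Space M] [IsFiniteMeasure (riemVol d : Measure M)]
    (hX : IsC1Field X)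
    (he : e ∈ atlas (EuclideanSpace ℝ (Fin d)) M) (he' : e' ∈ atlas (EuclideanSpace ℝ (Fin d)) M) :
    Set.EqOn (chartDiv d e X) (chartDiv d e' X) (e.source ∩ e'.source) := by
  have hopen : IsOpen (e.source ∩ e'.source) := e.open_source.inter e'.open_source
  have hc : ContinuousOn (chartDiv d e X) (e.source ∩ e'.source) :=
    (hX.continuousOn_chartDiv he).mono Set.inter_subset_left
  have hc' : ContinuousOn (chartDiv d e' X) (e.source ∩ e'.source) :=
    (hX.continuousOn_chartDiv he').mono Set.inter_subset_right
  have := riemVol_isOpenPosMeasure (d := d) (M := M)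
  have hm : SecondCountableTopology M :=
    ChartedSpace.secondCountable_of_sigmaCompact (EuclideanSpace ℝ (Fin d)) M
  have hae : ∀ᵐ x ∂(riemVol d), x ∈ e.source ∩ e'.source →
      chartDiv d e X x - chartDiv d e' X x = 0 := by
    refine hopen.ae_eq_zero_of_integral_contMDiff_smul_eq_zero (𝓡 d)
      ((hc.sub hc').locallyIntegrableOn hopen.measurableSet) fun g hg _ hgs => ?_
    have hg1 : ContMDiff (𝓡 d) 𝓘(ℝ, ℝ) 1 g := hg.of_le (by norm_cast)
    have h1 := hX.integral_local he hg1 (hgs.trans Set.inter_subset_left)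
    have h2 := hX.integral_local he' hg1 (hgs.trans Set.inter_subset_right)
    have hi : ∀ e₀ ∈ atlas (EuclideanSpace ℝ (Fin d)) M, tsupport g ⊆ e₀.source →
        Integrable (fun x => g x * chartDiv d e₀ X x + inner ℝ (grad d g x) (X x)) (riemVol d) :=
      fun e₀ he₀ hg₀ => ((hX.continuous_local he₀ hg1.continuous hg₀).add
        (hX.continuous_inner_grad hg1)).integrable_of_hasCompactSupport
          (HasCompactSupport.of_compactSpace _)
    have h3 := integral_sub (hi e he (hgs.trans Set.inter_subset_left))
      (hi e' he' (hgs.trans Set.inter_subset_right))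
    rw [h1, h2, sub_zero] at h3
    rw [← h3]
    refine integral_congr_ae (Eventually.of_forall fun x => ?_)
    simp only [smul_eq_mul]
    ring
  refine Measure.eqOn_open_of_ae_eq (μ := riemVol d) ?_ hopen hc hc'
  rw [EventuallyEq, ae_restrict_iff' hopen.measurableSet]
  filter_upwards [hae] with x hx hx'
  exact sub_eq_zero.1 (hx hx')

theorem IsC1Field.divergence_eq [CompactSpace M] [T2Space M]
    [IsFiniteMeasure (riemVol d : Measure M)] (hX : IsC1Field X)
    (he : e ∈ atlas (EuclideanSpace ℝ (Fin d)) M) :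
    Set.EqOn (divergence d X) (chartDiv d e X) e.source := fun x hx =>
  hX.chartDiv_eq (chart_mem_atlas _ x) he ⟨mem_chart_source _ x, hx⟩

theorem IsC1Field.continuous_divergence [CompactSpace M] [T2Space M]
    [IsFiniteMeasure (riemVol d : Measure M)] (hX : IsC1Field X) :
    Continuous (divergence d X) := by
  rw [continuous_iff_continuousAt]
  intro x
  have hx := (chartAt (EuclideanSpace ℝ (Fin d)) x).open_source.mem_nhds (mem_chart_source _ x)
  refine ((hX.continuousOn_chartDiv (chart_mem_atlas _ x)).continuousAt hx).congr ?_
  filter_upwards [hx] with z hz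
  exact (hX.divergence_eq (chart_mem_atlas _ x) hz).symm

/-- The divergence theorem on a compact manifold. -/
theorem IsC1Field.integral_mul_divergence [CompactSpace M] [T2Space M]
    [IsFiniteMeasure (riemVol d : Measure M)] (hX : IsC1Field X)
    (h : C^∞⟮𝓡 d, M; 𝓘(ℝ, ℝ), ℝ⟯) :
    ∫ x, h x * divergence d X x ∂(riemVol d) = -∫ x, inner ℝ (grad d h x) (X x) ∂(riemVol d) := by
  have hm : SecondCountableTopology M :=
    ChartedSpace.secondCountable_of_sigmaCompact (EuclideanSpace ℝ (Fin d)) M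
  have hi : ∀ F : M → ℝ, Continuous F → Integrable F (riemVol d) := fun F hF =>
    hF.integrable_of_hasCompactSupport (HasCompactSupport.of_compactSpace _)
  have hi1 : ∀ f : C^∞⟮𝓡 d, M; 𝓘(ℝ, ℝ), ℝ⟯,
      Integrable (fun x => f x * divergence d X x) (riemVol d) := fun f =>
    hi _ (f.contMDiff.continuous.mul hX.continuous_divergence)
  have hi2 : ∀ f : C^∞⟮𝓡 d, M; 𝓘(ℝ, ℝ), ℝ⟯,
      Integrable (fun x => (inner ℝ (grad d f x) (X x) : ℝ)) (riemVol d) := fun f =>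
    hi _ (hX.continuous_inner_grad (f.contMDiff.of_le (by norm_cast)))
  -- The defect of the formula is additive in the test function, so it is enough that it vanishes on
  -- each piece ρ i · h, which is supported in one chart.
  let Λ : C^∞⟮𝓡 d, M; 𝓘(ℝ, ℝ), ℝ⟯ →+ ℝ :=
    AddMonoidHom.mk'
      (fun f => ∫ x, (f x * divergence d X x + inner ℝ (grad d f x) (X x)) ∂(riemVol d))
      fun f f' => by
        refine Eq.trans ?_ (integral_add ((hi1 f).add (hi2 f)) ((hi1 f').add (hi2 f')))
        refine integral_congr_ae (Eventually.of_forall fun x => ?_)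
        beta_reduce
        rw [grad_add, inner_add_left, ContMDiffMap.coe_add, Pi.add_apply]
        ring
  obtain ⟨ρ, hρ⟩ := SmoothPartitionOfUnity.exists_isSubordinate_chartAt_source (𝓡 d) M
  have hfin := ρ.locallyFinite.finite_nonempty_of_compact
  have hsum : h = ∑ i ∈ hfin.toFinset, ρ i * h := by
    rw [← Finset.sum_mul]
    have h1 : ∑ i ∈ hfin.toFinset, ρ i = 1 := by
      ext x
      have h2 := ρ.sum_eq_one (Set.mem_univ x)
      rw [finsum_eq_sum_of_support_subset (s := hfin.toFinset)] at h2
      · have h3 := congrFun (map_sum (ContMDiffMap.coeFnAddMonoidHom (I := 𝓡 d) (N := M)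
          (I' := 𝓘(ℝ, ℝ)) (G := ℝ) (n := ∞)) (fun i => ρ i) hfin.toFinset) x
        rw [Finset.sum_apply] at h3
        exact h3.trans h2
      · intro i hi
        simp only [Set.Finite.coe_toFinset, Set.mem_ofPred_eq]
        exact ⟨x, hi⟩
    rw [h1, one_mul]
  have hΛ : Λ h = 0 := by
    rw [hsum, map_sum]
    refine Finset.sum_eq_zero fun i _ => ?_
    have hs : tsupport (⇑(ρ i * h)) ⊆ (chartAt (EuclideanSpace ℝ (Fin d)) i).source :=
      (closure_mono (by
        rw [ContMDiffMap.coe_mul]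
        exact Function.support_mul_subset_left _ _)).trans (hρ i)
    rw [← hX.integral_local (chart_mem_atlas _ i)
      ((ρ i * h).contMDiff.of_le (by norm_cast)) hs]
    refine integral_congr_ae (Eventually.of_forall fun x => ?_)
    simp only
    congr 1
    -- Outside the chart domain the two divergences may differ, but there the test function
    -- vanishes.
    by_cases hx : x ∈ (chartAt (EuclideanSpace ℝ (Fin d)) i).source
    · rw [hX.divergence_eq (chart_mem_atlas _ i) hx]
    · have h0 : (ρ i * h) x = 0 := image_eq_zero_of_notMem_tsupport fun h' => hx (hs h')
      rw [h0, zero_mul, zero_mul]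
  have hΛ' : ∫ x, (h x * divergence d X x + inner ℝ (grad d h x) (X x)) ∂(riemVol d) = 0 := hΛ
  rw [integral_add (hi1 h) (hi2 h)] at hΛ'
  linarith

end Divergence

/-! ### Integration by parts for the weighted measure, and density -/

section Gibbs

variable {d : ℕ} {M : Type*} [TopologicalSpace M] [ChartedSpace (EuclideanSpace ℝ (Fin d)) M]
  [IsManifold (𝓡 d) ∞ M] [RiemannianBundle (fun x : M => TangentSpace (𝓡 d) x)]
  {X : (x : M) → TangentSpace (𝓡 d) x} {U : M → ℝ}

theorem coordComp_smul (e : OpenPartialHomeomorph M (EuclideanSpace ℝ (Fin d))) (k : M → ℝ)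
    (X : (x : M) → TangentSpace (𝓡 d) x) (y : EuclideanSpace ℝ (Fin d)) :
    coordComp d e (fun x => k x • X x) y = k (e.symm y) • coordComp d e X y :=
  map_smul (mfderiv (𝓡 d) (𝓡 d) e (e.symm y)) _ _

theorem grad_mul (f h : C^∞⟮𝓡 d, M; 𝓘(ℝ, ℝ), ℝ⟯) (x : M) :
    grad d (⇑(f * h)) x = f x • grad d h x + h x • grad d f x := by
  have hf := (f.mdifferentiableAt (x := x)).hasMFDerivAt
  have hh := (h.mdifferentiableAt (x := x)).hasMFDerivAt
  have key : mfderiv (𝓡 d) 𝓘(ℝ, ℝ) (⇑(f * h)) x =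
      @HAdd.hAdd (TangentSpace (𝓡 d) x →L[ℝ] ℝ) (TangentSpace (𝓡 d) x →L[ℝ] ℝ)
        (TangentSpace (𝓡 d) x →L[ℝ] ℝ) _
        (f x • (mfderiv (𝓡 d) 𝓘(ℝ, ℝ) h x : TangentSpace (𝓡 d) x →L[ℝ] ℝ))
        (h x • (mfderiv (𝓡 d) 𝓘(ℝ, ℝ) f x : TangentSpace (𝓡 d) x →L[ℝ] ℝ)) :=
    (hf.mul hh).mfderiv
  unfold grad
  refine (congrArg (InnerProductSpace.toDual ℝ (TangentSpace (𝓡 d) x)).symm key).trans ?_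
  refine (map_add (InnerProductSpace.toDual ℝ (TangentSpace (𝓡 d) x)).symm _ _).trans ?_
  exact congrArg₂ (· + ·)
    ((InnerProductSpace.toDual ℝ (TangentSpace (𝓡 d) x)).symm.map_smulₛₗ (f x) _)
    ((InnerProductSpace.toDual ℝ (TangentSpace (𝓡 d) x)).symm.map_smulₛₗ (h x) _)

theorem isC1Field_of_contMDiff (hX : ContMDiff (𝓡 d) (𝓡 d).tangent 1
    (fun x => (⟨x, X x⟩ : TangentBundle (𝓡 d) M))) : IsC1Field X := fun _ he =>
  contDiffOn_coordComp (n := 1) hX he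

theorem IsC1Field.exp_neg_smul (hX : IsC1Field X) (hU : ContMDiff (𝓡 d) 𝓘(ℝ, ℝ) 1 U) :
    IsC1Field fun x => Real.exp (-U x) • X x := fun e he => by
  have h1 : ContDiffOn ℝ 1 (fun y => Real.exp (-U (e.symm y)) • coordComp d e X y) e.target :=
    (contDiffOn_comp_chart_symm (n := 1) hU he).neg.exp.smul (hX e he)
  exact h1.congr fun y _ => coordComp_smul e (fun x => Real.exp (-U x)) X y

variable [IsContMDiffRiemannianBundle (𝓡 d) ∞ (EuclideanSpace ℝ (Fin d))
    (fun x : M => TangentSpace (𝓡 d) x)]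

theorem isC1Field_grad (f : C^∞⟮𝓡 d, M; 𝓘(ℝ, ℝ), ℝ⟯) : IsC1Field (grad d f) := fun _ he =>
  (contDiffOn_coordComp_grad he f).of_le (by norm_cast)

theorem continuous_inner_self (hX : ContMDiff (𝓡 d) (𝓡 d).tangent 1
    (fun x => (⟨x, X x⟩ : TangentBundle (𝓡 d) M))) :
    Continuous fun x => (inner ℝ (X x) (X x) : ℝ) := by
  have : IsContMDiffRiemannianBundle (𝓡 d) 1 (EuclideanSpace ℝ (Fin d))
      (fun x : M => TangentSpace (𝓡 d) x) :=
    IsContMDiffRiemannianBundle.of_le (n := ∞) (by norm_cast)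
  exact (ContMDiff.inner_bundle (E := fun x : M => TangentSpace (𝓡 d) x) hX hX).continuous

/-- The product rule in one chart. For X = ∇f the bracket is A_o f, which explains the drift -∇U in
the generator. -/
theorem IsC1Field.divergence_exp_neg_smul (hX : IsC1Field X)
    (hU : ContMDiff (𝓡 d) 𝓘(ℝ, ℝ) 1 U) (x : M) :
    divergence d (fun x => Real.exp (-U x) • X x) x =
      Real.exp (-U x) * (divergence d X x - inner ℝ (grad d U x) (X x)) := by
  rw [divergence_eq_chartDiv, divergence_eq_chartDiv]
  set e := chartAt (EuclideanSpace ℝ (Fin d)) x with he_def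
  have he : e ∈ atlas (EuclideanSpace ℝ (Fin d)) M := chart_mem_atlas _ x
  have hx : x ∈ e.source := mem_chart_source _ x
  have hy := e.map_source hx
  have hUd : DifferentiableAt ℝ (U ∘ e.symm) (e x) :=
    ((contDiffOn_comp_chart_symm (n := 1) hU he).differentiableOn one_ne_zero).differentiableAt
      (e.open_target.mem_nhds hy)
  have hg : ∀ j, DifferentiableAt ℝ (fun y => sqrtDet d e y * coordComp d e X y j) (e x) :=
    fun j => ((hX.contDiffOn_mul he j).differentiableOn one_ne_zero).differentiableAt
      (e.open_target.mem_nhds hy)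
  have h1 : ∀ j : Fin d, fderiv ℝ (fun y => sqrtDet d e y *
      coordComp d e (fun x => Real.exp (-U x) • X x) y j) (e x) (EuclideanSpace.single j 1) =
      Real.exp (-U x) * (fderiv ℝ (fun y => sqrtDet d e y * coordComp d e X y j) (e x)
        (EuclideanSpace.single j 1) - sqrtDet d e (e x) * (coordComp d e X (e x) j *
          fderiv ℝ (U ∘ e.symm) (e x) (EuclideanSpace.single j 1))) := by
    intro j
    have h2 : (fun y => sqrtDet d e y * coordComp d e (fun x => Real.exp (-U x) • X x) y j) =
        fun y => Real.exp (-(U ∘ e.symm) y) * (sqrtDet d e y * coordComp d e X y j) := by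
      ext y
      rw [coordComp_smul e (fun x => Real.exp (-U x)), PiLp.smul_apply, smul_eq_mul,
        Function.comp_apply]
      ring
    rw [h2, (hUd.hasFDerivAt.fun_neg.exp.fun_mul (hg j).hasFDerivAt).fderiv]
    simp only [Function.comp_apply, e.left_inv hx, add_apply, smul_apply, neg_apply, smul_eq_mul]
    ring
  simp only [chartDiv, h1]
  have h3 := sum_coordComp_mul_fderiv_eq_inner he hy (h := U) (hU.mdifferentiableAt one_ne_zero) X
  rw [← Finset.mul_sum, Finset.sum_sub_distrib, ← Finset.mul_sum, h3, e.left_inv hx]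
  have h4 := (sqrtDet_pos he hy).ne'
  field_simp

variable [MeasurableSpace M] [BorelSpace M] [CompactSpace M]

/-- `U` is bounded on the compact manifold, so the volume is at most a constant times π. -/
theorem isFiniteMeasure_riemVol (hU : Continuous U) [IsFiniteMeasure (gibbs d U)] :
    IsFiniteMeasure (riemVol d : Measure M) := by
  obtain ⟨C, hC⟩ := isCompact_univ.exists_bound_of_continuousOn hU.continuousOn
  have h1 : ENNReal.ofReal (Real.exp (-C)) * riemVol d (Set.univ : Set M) ≤
      gibbs d U Set.univ := by
    rw [gibbs, withDensity_apply _ MeasurableSet.univ, Measure.restrict_univ, ← lintegral_const]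
    refine lintegral_mono fun x => ENNReal.ofReal_le_ofReal (Real.exp_le_exp.2 (neg_le_neg ?_))
    exact (le_abs_self _).trans (hC x (Set.mem_univ x))
  refine ⟨lt_top_iff_ne_top.2 fun h => ?_⟩
  rw [h, ENNReal.mul_top (by simpa using Real.exp_pos _)] at h1
  exact (measure_lt_top (gibbs d U) Set.univ).not_ge h1

theorem integral_gibbs (hU : Continuous U) (F : M → ℝ) :
    ∫ x, F x ∂(gibbs d U) = ∫ x, Real.exp (-U x) * F x ∂(riemVol d) := by
  rw [gibbs, integral_withDensity_eq_integral_toReal_smul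
    (by fun_prop) (Eventually.of_forall fun x => ENNReal.ofReal_lt_top)]
  refine integral_congr_ae (Eventually.of_forall fun x => ?_)
  simp only [smul_eq_mul]
  rw [ENNReal.toReal_ofReal (Real.exp_pos _).le]

variable [T2Space M]

/-- Smooth functions are uniformly dense among the continuous ones, and these are dense in L². -/
theorem denseRange_toL2 (μ : Measure M) [IsFiniteMeasure μ] : DenseRange (toL2 d μ) := by
  have hm : SecondCountableTopology M :=
    ChartedSpace.secondCountable_of_sigmaCompact (EuclideanSpace ℝ (Fin d)) M
  have hm' : TopologicalSpace.MetrizableSpace M := Manifold.metrizableSpace (𝓡 d) M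
  have h1 : DenseRange (fun f : C^∞⟮𝓡 d, M; 𝓘(ℝ, ℝ), ℝ⟯ =>
      (⟨f, f.contMDiff.continuous⟩ : C(M, ℝ))) := by
    rw [Metric.denseRange_iff]
    intro f ε hε
    obtain ⟨g, hg, -⟩ := f.continuous.exists_contMDiff_approx (𝓡 d) (⊤ : ℕ∞)
      (continuous_const (y := ε)) (fun _ => hε)
    refine ⟨g, ?_⟩
    rw [ContinuousMap.dist_lt_iff hε]
    intro x
    rw [dist_comm]
    exact hg x
  exact (ContinuousMap.toLp_denseRange ℝ μ ℝ (p := 2) (by simp)).comp h1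
    (ContinuousMap.toLp 2 μ ℝ).continuous

theorem integral_inner_grad_gibbs_eq_zero (hU : ContMDiff (𝓡 d) 𝓘(ℝ, ℝ) 1 U)
    [IsFiniteMeasure (gibbs d U)] (hX : IsC1Field X)
    (hdiv : ∀ x, divergence d (fun y => Real.exp (-U y) • X y) x = 0)
    (f : C^∞⟮𝓡 d, M; 𝓘(ℝ, ℝ), ℝ⟯) : ∫ x, inner ℝ (X x) (grad d f x) ∂(gibbs d U) = 0 := by
  have := isFiniteMeasure_riemVol (d := d) hU.continuous
  have h1 := (hX.exp_neg_smul hU).integral_mul_divergence f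
  simp only [hdiv, mul_zero, integral_zero, real_inner_smul_right] at h1
  rw [integral_gibbs hU.continuous]
  simp only [real_inner_comm (X _)] at h1 ⊢
  linarith

/-- The derivation X·∇ has integral zero against π on every smooth function, by the divergence
theorem for e^{-U}X. Applying this to the product `f * h` and using the Leibniz rule gives
antisymmetry. -/
theorem integral_drift_mul (hU : ContMDiff (𝓡 d) 𝓘(ℝ, ℝ) 1 U)
    [IsFiniteMeasure (gibbs d U)] (hX : IsC1Field X)
    (hdiv : ∀ x, divergence d (fun y => Real.exp (-U y) • X y) x = 0)
    (f h : C^∞⟮𝓡 d, M; 𝓘(ℝ, ℝ), ℝ⟯) :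
    ∫ x, inner ℝ (X x) (grad d f x) * h x ∂(gibbs d U) =
      -∫ x, inner ℝ (X x) (grad d h x) * f x ∂(gibbs d U) := by
  have h1 := integral_inner_grad_gibbs_eq_zero hU hX hdiv (f * h)
  have hi : ∀ f h : C^∞⟮𝓡 d, M; 𝓘(ℝ, ℝ), ℝ⟯,
      Integrable (fun x => inner ℝ (X x) (grad d f x) * h x) (gibbs d U) := fun f h => by
    have hc : Continuous fun x => inner ℝ (X x) (grad d f x) := by
      simp only [real_inner_comm (grad d _ _)]
      exact hX.continuous_inner_grad (f.contMDiff.of_le (by norm_cast))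
    exact (hc.mul h.contMDiff.continuous).integrable_of_hasCompactSupport
      (HasCompactSupport.of_compactSpace _)
  rw [eq_neg_iff_add_eq_zero, ← integral_add (hi f h) (hi h f), ← h1]
  refine integral_congr_ae (Eventually.of_forall fun x => ?_)
  beta_reduce
  rw [grad_mul, inner_add_right, real_inner_smul_right, real_inner_smul_right]
  ring

theorem continuous_coreOp (hU : ContMDiff (𝓡 d) 𝓘(ℝ, ℝ) 1 U) [IsFiniteMeasure (gibbs d U)]
    (f : C^∞⟮𝓡 d, M; 𝓘(ℝ, ℝ), ℝ⟯) : Continuous (coreOp d U f) := by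
  have := isFiniteMeasure_riemVol (d := d) hU.continuous
  exact (isC1Field_grad f).continuous_divergence.sub ((isC1Field_grad f).continuous_inner_grad hU)

/-- This is the divergence theorem for the field e^{-U}∇f, tested against h. -/
theorem energy_gibbs_eq (hU : ContMDiff (𝓡 d) 𝓘(ℝ, ℝ) 1 U) [IsFiniteMeasure (gibbs d U)]
    (f h : C^∞⟮𝓡 d, M; 𝓘(ℝ, ℝ), ℝ⟯) :
    energy d (gibbs d U) f h = -∫ x, coreOp d U f x * h x ∂(gibbs d U) := by
  have := isFiniteMeasure_riemVol (d := d) hU.continuous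
  have h1 := ((isC1Field_grad f).exp_neg_smul hU).integral_mul_divergence h
  simp only [(isC1Field_grad f).divergence_exp_neg_smul hU, real_inner_smul_right] at h1
  rw [energy, integral_gibbs hU.continuous, integral_gibbs hU.continuous, eq_neg_iff_add_eq_zero]
  simp only [real_inner_comm (grad d h _)] at h1 ⊢
  have h2 : ∫ x, Real.exp (-U x) * (coreOp d U f x * h x) ∂(riemVol d) =
      ∫ x, h x * (Real.exp (-U x) * (divergence d (grad d f) x -
        inner ℝ (grad d U x) (grad d f x))) ∂(riemVol d) := by
    refine integral_congr_ae (Eventually.of_forall fun x => ?_)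
    simp only [coreOp, laplacian]
    ring
  rw [h2, h1]
  ring

end Gibbs

end DriftLimit

/-! ### The theorem -/

theorem theoremL5 {d : ℕ} {M : Type*} [TopologicalSpace M] [T2Space M] [CompactSpace M]
    [ChartedSpace (EuclideanSpace ℝ (Fin d)) M] [IsManifold (𝓡 d) ∞ M]
    [RiemannianBundle (fun x : M => TangentSpace (𝓡 d) x)]
    [IsContMDiffRiemannianBundle (𝓡 d) ∞ (EuclideanSpace ℝ (Fin d))
      (fun x : M => TangentSpace (𝓡 d) x)]
    [MeasurableSpace M] [BorelSpace M]
    (U : M → ℝ) (hU : ContMDiff (𝓡 d) 𝓘(ℝ, ℝ) 1 U)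
    [IsProbabilityMeasure (DriftLimit.gibbs d U)]
    (b : (x : M) → TangentSpace (𝓡 d) x)
    (hb : ContMDiff (𝓡 d) (𝓡 d).tangent 1
      (fun x => (⟨x, b x⟩ : TangentBundle (𝓡 d) M)))
    (hdiv : ∀ x, DriftLimit.divergence d (fun y => Real.exp (-U y) • b y) x = 0)
    (lam : ℝ) (hlam : 0 < lam) :
    -- the objects in the claim are well defined
    DriftLimit.IsShiftInverse (DriftLimit.generator d U) lam
      (DriftLimit.shiftInverse (DriftLimit.generator d U) lam) ∧
    (∀ c : ℝ, DriftLimit.IsShiftInverse (DriftLimit.driftGenerator d U b c) lam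
      (DriftLimit.shiftInverse (DriftLimit.driftGenerator d U b c) lam)) ∧
    (∀ u ∈ DriftLimit.sobolevH1 d (DriftLimit.gibbs d U),
      ∃! p, DriftLimit.IsKerProj d (DriftLimit.gibbs d U) b lam u p) ∧
    -- the convergence in `H¹`
    ∀ g : Lp ℝ 2 (DriftLimit.gibbs d U),
      (∀ c : ℝ, DriftLimit.resolventOp (DriftLimit.driftGenerator d U b c) lam g ∈
        DriftLimit.sobolevH1 d (DriftLimit.gibbs d U)) ∧
      DriftLimit.shiftInverse (DriftLimit.generator d U) lam g ∈
        DriftLimit.sobolevH1 d (DriftLimit.gibbs d U) ∧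
      DriftLimit.limitResolvent d U b lam g ∈ DriftLimit.driftKer d (DriftLimit.gibbs d U) b ∧
      Tendsto (fun c : ℝ => DriftLimit.normH1 d (DriftLimit.gibbs d U)
          (DriftLimit.resolventOp (DriftLimit.driftGenerator d U b c) lam g -
            DriftLimit.limitResolvent d U b lam g))
        (Bornology.cobounded ℝ) (𝓝 0) ∧
      -- the subspace of functions of mean zero is preserved
      (∫ x, g x ∂(DriftLimit.gibbs d U) = 0 →
        (∀ c : ℝ, ∫ x, DriftLimit.resolventOp (DriftLimit.driftGenerator d U b c) lam g x
          ∂(DriftLimit.gibbs d U) = 0) ∧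
        ∫ x, DriftLimit.limitResolvent d U b lam g x ∂(DriftLimit.gibbs d U) = 0) := by
  have hbX : DriftLimit.IsC1Field b := DriftLimit.isC1Field_of_contMDiff hb
  have hcore := fun f : C^∞⟮𝓡 d, M; 𝓘(ℝ, ℝ), ℝ⟯ => DriftLimit.continuous_coreOp hU f
  have hbb : Continuous fun x => (inner ℝ (b x) (b x) : ℝ) :=
    DriftLimit.continuous_inner_self hb
  -- The length of `b` is the root of ⟨b, b⟩, a continuous function on a compact space, hence
  -- bounded.
  obtain ⟨C, hC⟩ := isCompact_univ.exists_bound_of_continuousOn hbb.sqrt.continuousOn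
  have hL := fun f : C^∞⟮𝓡 d, M; 𝓘(ℝ, ℝ), ℝ⟯ =>
    ContinuousMap.coeFn_toLp (𝕜 := ℝ) (p := 2) (DriftLimit.gibbs d U)
      (⟨DriftLimit.coreOp d U f, hcore f⟩ : C(M, ℝ))
  refine DriftLimit.resolvent_limit_of_integration_by_parts U b hL (fun f h => ?_)
    (DriftLimit.denseRange_toL2 _) (fun f => ?_) (C := C) (fun x => ?_)
    (DriftLimit.integral_drift_mul hU hbX hdiv) lam hlam
  · rw [DriftLimit.inner_toL2 _ _ _ (hL f), DriftLimit.energy_gibbs_eq hU]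
    rfl
  · simp only [real_inner_comm (DriftLimit.grad d _ _)]
    exact hbX.continuous_inner_grad (f.contMDiff.of_le (by norm_cast))
  · rw [norm_eq_sqrt_real_inner]
    exact (le_abs_self _).trans (hC x (Set.mem_univ x))
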